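/- Let $\ell_1,\ell_2,a>0$ and let $R=[0,\ell_1]\times[0,\ell_2]\times[0,a]$, with coordinates $(x,y,z)$. Consider on $L^2(R)=L^2(R;\mathbb C)$ the form $$\mathfrak q[u]=\int_R|\nabla u|^2\,dx\,dy\,dz,\qquad \operatorname{Dom}(\mathfrak q)=\{u\in H^1(R): u|_{z=0}=u|_{z=a}=0\text{ in the trace sense}\},$$ and let $L$ be the operator associated with $\mathfrak q$: $u\in\operatorname{Dom}(L)$ and $Lu=f\in L^2(R)$ if and only if $u\in\operatorname{Dom}(\mathfrak q)$ and $\sum_{i=1}^{3}\langle\partial_i u,\partial_i v\rangle=\langle f,v\rangle$ for all $v\in\operatorname{Dom}(\mathfrak q)$. Then: 1. $L$ is a well-defined, positive (i.e. $\langle Lu,u\rangle\ge 0$), self-adjoint operator. 2. $L$ is the Laplacian on $R$ with Neumann conditions on the lateral faces $x=0,\ell_1$ and $y=0,\ell_2$ and Dirichlet conditions on the plate faces $z=0,a$. That is, $\operatorname{Dom}(L)$ consists exactly of the $u\in H^2(R)$ such that, in the trace sense, $\partial_xu=0$ on $x=0$ and $x=\ell_1$, $\partial_yu=0$ on $y=0$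 and $y=\ell_2$, and $u=0$ on $z=0$ and $z=a$; and $Lu=-\Delta u$ for $u\in\operatorname{Dom}(L)$. 3. The eigenvalues of $L$ are exactly the numbers $$\lambda_{m,n,r}=\frac{\pi^2m^2}{\ell_1^2}+\frac{\pi^2n^2}{\ell_2^2}+\frac{\pi^2r^2}{a^2},\qquad m,n\in\{0,1,2,\dots\},\quad r\in\{1,2,3,\dots\},$$ counted with multiplicity: the eigenspace of each $\mu\in\mathbb C$ has finite dimension, equal to the number of triples $(m,n,r)$ with $\lambda_{m,n,r}=\mu$, and $L^2(R)$ has an orthonormal basis $(e_{m,n,r})$ with $e_{m,n,r}\in\operatorname{Dom}(L)$ and $Le_{m,n,r}=\lambda_{m,n,r}e_{m,n,r}$. -/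

import Mathlib

open MeasureTheory Filter Set
open scoped ENNReal ContDiff Topology InnerProductSpace

namespace MixedCell

noncomputable section

/-- The (open) rectangular cell `(0, ℓ 0) × (0, ℓ 1) × (0, ℓ 2)`. -/
def box (ℓ : Fin 3 → ℝ) : Set (Fin 3 → ℝ) :=
  Set.pi univ fun i => Ioo 0 (ℓ i)

/-- Lebesgue measure on the cell. -/
abbrev cellMeasure (ℓ : Fin 3 → ℝ) : Measure (Fin 3 → ℝ) :=
  volume.restrict (box ℓ)

/-- The complex Hilbert space `L²` of the cell. -/
abbrev CellL2 (ℓ : Fin 3 → ℝ) : Type :=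
  Lp ℂ 2 (cellMeasure ℓ)

/-- Two-dimensional Lebesgue measure on a face orthogonal to the `i`-th axis; such a face is
parametrised by the two remaining coordinates. -/
abbrev faceMeasure (ℓ : Fin 3 → ℝ) (i : Fin 3) : Measure (Fin 2 → ℝ) :=
  volume.restrict (Set.pi univ fun j => Ioo 0 (ℓ (i.succAbove j)))

/-- The complex Hilbert space `L²` of a face orthogonal to the `i`-th axis. -/
abbrev FaceL2 (ℓ : Fin 3 → ℝ) (i : Fin 3) : Type :=
  Lp ℂ 2 (faceMeasure ℓ i)

/-- The classical partial derivative in the `i`-th coordinate direction. -/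
def pderiv {F : Type*} [NormedAddCommGroup F] [NormedSpace ℝ F]
    (i : Fin 3) (φ : (Fin 3 → ℝ) → F) (x : Fin 3 → ℝ) : F :=
  fderiv ℝ φ x (Pi.single i 1)

/-- `w` is the weak `i`-th partial derivative of `u` on the cell. -/
def IsWeakDeriv {ℓ : Fin 3 → ℝ} (i : Fin 3) (u w : CellL2 ℓ) : Prop :=
  ∀ φ : (Fin 3 → ℝ) → ℝ, ContDiff ℝ ∞ φ → HasCompactSupport φ → tsupport φ ⊆ box ℓ →
    ∫ x, pderiv i φ x • u x ∂(cellMeasure ℓ) = - ∫ x, φ x • w x ∂(cellMeasure ℓ)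

open Classical in
/-- The weak `i`-th partial derivative in `L²` of the cell (set to `0` where there is none). -/
def weakDeriv {ℓ : Fin 3 → ℝ} (i : Fin 3) (u : CellL2 ℓ) : CellL2 ℓ :=
  if h : ∃ w, IsWeakDeriv i u w then h.choose else 0

/-- `u` belongs to the Sobolev space `H¹` of the cell. -/
def MemH1 {ℓ : Fin 3 → ℝ} (u : CellL2 ℓ) : Prop :=
  ∀ i, ∃ w, IsWeakDeriv i u w

/-- `u` belongs to the Sobolev space `H²` of the cell. -/
def MemH2 {ℓ : Fin 3 → ℝ} (u : CellL2 ℓ) : Prop :=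
  MemH1 u ∧ ∀ i, MemH1 (weakDeriv i u)

/-- The functions `φ n`, restricted to the cell, converge to `u` in `H¹`. -/
def TendstoH1 {ℓ : Fin 3 → ℝ} (φ : ℕ → (Fin 3 → ℝ) → ℂ) (u : CellL2 ℓ) : Prop :=
  Tendsto (fun n => eLpNorm (fun x => φ n x - u x) 2 (cellMeasure ℓ)) atTop (𝓝 0) ∧
  ∀ i, Tendsto (fun n => eLpNorm (fun x => pderiv i (φ n) x - weakDeriv i u x) 2 (cellMeasure ℓ))
    atTop (𝓝 0)

/-- `u ∈ H¹` has trace `g ∈ L²` on the face of the cell lying in the plane `x i = c`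
(with `c = 0` or `c = ℓ i`). The trace operator is the continuous extension to `H¹` of the
restriction to the face of functions smooth up to the boundary. -/
def HasTrace {ℓ : Fin 3 → ℝ} (i : Fin 3) (c : ℝ) (u : CellL2 ℓ) (g : FaceL2 ℓ i) : Prop :=
  MemH1 u ∧ ∃ φ : ℕ → (Fin 3 → ℝ) → ℂ, (∀ n, ContDiff ℝ ∞ (φ n)) ∧ TendstoH1 φ u ∧
    Tendsto (fun n => eLpNorm (fun y => φ n (i.insertNth c y) - g y) 2 (faceMeasure ℓ i))
      atTop (𝓝 0)

/-- The form domain: `H¹` functions with vanishing trace on the two plate faces `z = 0` and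
`z = ℓ 2`, and no condition on the lateral faces. -/
def MemFormDomain {ℓ : Fin 3 → ℝ} (u : CellL2 ℓ) : Prop :=
  MemH1 u ∧ HasTrace 2 0 u 0 ∧ HasTrace 2 (ℓ 2) u 0

/-- The (sesquilinear) Dirichlet energy form; `cellForm u u = ∫ |∇u|²`. -/
def cellForm {ℓ : Fin 3 → ℝ} (u v : CellL2 ℓ) : ℂ :=
  ∑ i, ⟪weakDeriv i u, weakDeriv i v⟫_ℂ

/-- The weak Laplacian of an `H²` function. -/
def weakLaplacian {ℓ : Fin 3 → ℝ} (u : CellL2 ℓ) : CellL2 ℓ :=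
  ∑ i, weakDeriv i (weakDeriv i u)

section helpers

variable {ℓ : Fin 3 → ℝ} {i : Fin 3}

theorem isOpen_box (ℓ : Fin 3 → ℝ) : IsOpen (box ℓ) :=
  isOpen_set_pi finite_univ fun _ _ => isOpen_Ioo

instance (ℓ : Fin 3 → ℝ) : IsFiniteMeasure (cellMeasure ℓ) := by
  refine ⟨?_⟩
  rw [Measure.restrict_apply_univ]
  refine lt_of_le_of_lt (measure_mono (t := Set.Icc 0 ℓ) ?_) isCompact_Icc.measure_lt_top
  intro x hx
  exact ⟨fun i => (hx i trivial).1.le, fun i => (hx i trivial).2.le⟩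

theorem integrable_smul {φ : (Fin 3 → ℝ) → ℝ} (hc : Continuous φ) (hs : HasCompactSupport φ)
    (u : CellL2 ℓ) : Integrable (fun x => φ x • u x) (cellMeasure ℓ) := by
  obtain ⟨C, hC⟩ := hs.exists_bound_of_continuous hc
  exact ((Lp.memLp u).integrable (by norm_num)).bdd_smul C
    hc.aestronglyMeasurable (Eventually.of_forall hC)

theorem integrable_pderiv_smul {φ : (Fin 3 → ℝ) → ℝ} (hc : ContDiff ℝ ∞ φ)
    (hs : HasCompactSupport φ) (u : CellL2 ℓ) :
    Integrable (fun x => pderiv i φ x • u x) (cellMeasure ℓ) := by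
  refine integrable_smul ?_ ?_ u
  · exact (hc.continuous_fderiv (by simp)).clm_apply continuous_const
  · exact hs.fderiv_apply (𝕜 := ℝ) _

theorem IsWeakDeriv.unique {u w w' : CellL2 ℓ} (h : IsWeakDeriv i u w)
    (h' : IsWeakDeriv i u w') : w = w' := by
  have hi : LocallyIntegrableOn (fun x => w x - w' x) (box ℓ) (cellMeasure ℓ) :=
    (((Lp.memLp w).integrable (by norm_num)).sub
      ((Lp.memLp w').integrable (by norm_num))).locallyIntegrable.locallyIntegrableOn _
  have := (isOpen_box ℓ).ae_eq_zero_of_integral_contDiff_smul_eq_zero hi (fun φ hφ hs ht => by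
    simp only [smul_sub]
    rw [integral_sub (integrable_smul hφ.continuous hs w) (integrable_smul hφ.continuous hs w'),
      sub_eq_zero]
    exact neg_injective ((h φ hφ hs ht).symm.trans (h' φ hφ hs ht)))
  apply Lp.ext
  filter_upwards [this, ae_restrict_mem (isOpen_box ℓ).measurableSet] with x hx hm
  exact sub_eq_zero.1 (hx hm)

theorem IsWeakDeriv.weakDeriv_eq {u w : CellL2 ℓ} (h : IsWeakDeriv i u w) :
    weakDeriv i u = w := by
  have hex : ∃ w, IsWeakDeriv i u w := ⟨w, h⟩
  rw [weakDeriv, dif_pos hex]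
  exact hex.choose_spec.unique h

theorem MemH1.isWeakDeriv {u : CellL2 ℓ} (h : MemH1 u) (i : Fin 3) :
    IsWeakDeriv i u (weakDeriv i u) := by
  obtain ⟨w, hw⟩ := h i
  rwa [hw.weakDeriv_eq]

theorem IsWeakDeriv.add {u v w w' : CellL2 ℓ} (h : IsWeakDeriv i u w)
    (h' : IsWeakDeriv i v w') : IsWeakDeriv i (u + v) (w + w') := by
  intro φ hφ hs ht
  have e1 : ∫ x, pderiv i φ x • (u + v : CellL2 ℓ) x ∂(cellMeasure ℓ)
      = ∫ x, (pderiv i φ x • u x + pderiv i φ x • v x) ∂(cellMeasure ℓ) := by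
    apply integral_congr_ae
    filter_upwards [Lp.coeFn_add u v] with x hx
    rw [hx, Pi.add_apply, smul_add]
  have e2 : ∫ x, φ x • (w + w' : CellL2 ℓ) x ∂(cellMeasure ℓ)
      = ∫ x, (φ x • w x + φ x • w' x) ∂(cellMeasure ℓ) := by
    apply integral_congr_ae
    filter_upwards [Lp.coeFn_add w w'] with x hx
    rw [hx, Pi.add_apply, smul_add]
  rw [e1, e2, integral_add (integrable_pderiv_smul hφ hs u) (integrable_pderiv_smul hφ hs v),
    integral_add (integrable_smul hφ.continuous hs w) (integrable_smul hφ.continuous hs w'),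
    h φ hφ hs ht, h' φ hφ hs ht]
  ring

theorem IsWeakDeriv.smul {u w : CellL2 ℓ} (h : IsWeakDeriv i u w) (c : ℂ) :
    IsWeakDeriv i (c • u) (c • w) := by
  intro φ hφ hs ht
  have e1 : ∫ x, pderiv i φ x • (c • u : CellL2 ℓ) x ∂(cellMeasure ℓ)
      = ∫ x, c • (pderiv i φ x • u x) ∂(cellMeasure ℓ) := by
    apply integral_congr_ae
    filter_upwards [Lp.coeFn_smul c u] with x hx
    rw [hx, Pi.smul_apply, smul_comm]
  have e2 : ∫ x, φ x • (c • w : CellL2 ℓ) x ∂(cellMeasure ℓ)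
      = ∫ x, c • (φ x • w x) ∂(cellMeasure ℓ) := by
    apply integral_congr_ae
    filter_upwards [Lp.coeFn_smul c w] with x hx
    rw [hx, Pi.smul_apply, smul_comm]
  rw [e1, e2, integral_smul, integral_smul, h φ hφ hs ht, smul_neg]

theorem isWeakDeriv_zero : IsWeakDeriv i (0 : CellL2 ℓ) 0 := by
  have h0 : ∀ f : (Fin 3 → ℝ) → ℝ, ∫ x, f x • (0 : CellL2 ℓ) x ∂(cellMeasure ℓ) = 0 := by
    intro f
    apply integral_eq_zero_of_ae
    filter_upwards [Lp.coeFn_zero ℂ 2 (cellMeasure ℓ)] with x hx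
    rw [hx]
    simp
  intro φ hφ hs ht
  rw [h0, h0, neg_zero]

theorem MemH1.add {u v : CellL2 ℓ} (hu : MemH1 u) (hv : MemH1 v) : MemH1 (u + v) :=
  fun i => ⟨_, (hu.isWeakDeriv i).add (hv.isWeakDeriv i)⟩

theorem MemH1.smul {u : CellL2 ℓ} (hu : MemH1 u) (c : ℂ) : MemH1 (c • u) :=
  fun i => ⟨_, (hu.isWeakDeriv i).smul c⟩

theorem memH1_zero : MemH1 (0 : CellL2 ℓ) := fun _ => ⟨0, isWeakDeriv_zero⟩

theorem weakDeriv_add {u v : CellL2 ℓ} (hu : MemH1 u) (hv : MemH1 v) (i : Fin 3) :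
    weakDeriv i (u + v) = weakDeriv i u + weakDeriv i v :=
  ((hu.isWeakDeriv i).add (hv.isWeakDeriv i)).weakDeriv_eq

theorem weakDeriv_smul {u : CellL2 ℓ} (hu : MemH1 u) (c : ℂ) (i : Fin 3) :
    weakDeriv i (c • u) = c • weakDeriv i u :=
  ((hu.isWeakDeriv i).smul c).weakDeriv_eq

theorem weakDeriv_zero (i : Fin 3) : weakDeriv i (0 : CellL2 ℓ) = 0 :=
  isWeakDeriv_zero.weakDeriv_eq

theorem tendsto_eLpNorm_add {X : Type*} [MeasurableSpace X] {μ : Measure X}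
    {f f' : ℕ → X → ℂ} {g g' : Lp ℂ 2 μ}
    (hf : ∀ n, AEStronglyMeasurable (f n) μ) (hf' : ∀ n, AEStronglyMeasurable (f' n) μ)
    (h : Tendsto (fun n => eLpNorm (fun x => f n x - g x) 2 μ) atTop (𝓝 0))
    (h' : Tendsto (fun n => eLpNorm (fun x => f' n x - g' x) 2 μ) atTop (𝓝 0)) :
    Tendsto (fun n => eLpNorm (fun x => (f n x + f' n x) - (g + g' : Lp ℂ 2 μ) x) 2 μ)
      atTop (𝓝 0) := by
  refine tendsto_of_tendsto_of_tendsto_of_le_of_le tendsto_const_nhds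
    (by simpa using h.add h') (fun _ => zero_le) (fun n => ?_)
  refine le_trans (le_of_eq (eLpNorm_congr_ae ?_)) (eLpNorm_add_le
    ((hf n).sub (Lp.aestronglyMeasurable g)) ((hf' n).sub (Lp.aestronglyMeasurable g'))
    (by norm_num))
  filter_upwards [Lp.coeFn_add g g'] with x hx
  simp only [hx, Pi.add_apply]
  ring

theorem tendsto_eLpNorm_smul {X : Type*} [MeasurableSpace X] {μ : Measure X}
    {f : ℕ → X → ℂ} {g : Lp ℂ 2 μ} (c : ℂ)
    (h : Tendsto (fun n => eLpNorm (fun x => f n x - g x) 2 μ) atTop (𝓝 0)) :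
    Tendsto (fun n => eLpNorm (fun x => c • f n x - (c • g : Lp ℂ 2 μ) x) 2 μ)
      atTop (𝓝 0) := by
  have := ENNReal.Tendsto.const_mul (a := ‖c‖ₑ) h (Or.inr enorm_ne_top)
  rw [mul_zero] at this
  refine this.congr fun n => ?_
  rw [← eLpNorm_const_smul]
  refine eLpNorm_congr_ae ?_
  filter_upwards [Lp.coeFn_smul c g] with x hx
  simp only [hx, Pi.smul_apply, smul_sub]

theorem continuous_pderiv {φ : (Fin 3 → ℝ) → ℂ} (h : ContDiff ℝ ∞ φ) (i : Fin 3) :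
    Continuous (pderiv i φ) :=
  (h.continuous_fderiv (by simp)).clm_apply continuous_const

theorem HasTrace.add {c : ℝ} {u v : CellL2 ℓ} {g g' : FaceL2 ℓ i} (hu : HasTrace i c u g)
    (hv : HasTrace i c v g') : HasTrace i c (u + v) (g + g') := by
  obtain ⟨h1, φ, hφ, ⟨a1, a2⟩, a3⟩ := hu
  obtain ⟨h1', ψ, hψ, ⟨b1, b2⟩, b3⟩ := hv
  refine ⟨h1.add h1', fun n x => φ n x + ψ n x, fun n => (hφ n).add (hψ n), ⟨?_, fun j => ?_⟩, ?_⟩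
  · exact tendsto_eLpNorm_add (fun n => (hφ n).continuous.aestronglyMeasurable)
      (fun n => (hψ n).continuous.aestronglyMeasurable) a1 b1
  · rw [weakDeriv_add h1 h1']
    have := tendsto_eLpNorm_add (fun n => (continuous_pderiv (hφ n) j).aestronglyMeasurable)
      (fun n => (continuous_pderiv (hψ n) j).aestronglyMeasurable) (a2 j) (b2 j)
    refine this.congr fun n => ?_
    congr 1
    funext x
    have e : pderiv j (fun x => φ n x + ψ n x) x = pderiv j (φ n) x + pderiv j (ψ n) x := by
      simp only [pderiv]
      rw [fderiv_fun_add ((hφ n).differentiable (by simp) x) ((hψ n).differentiable (by simp) x)]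
      rfl
    rw [e]
  · have hc : Continuous fun y : Fin 2 → ℝ => (i.insertNth c y : Fin 3 → ℝ) := by fun_prop
    exact tendsto_eLpNorm_add (fun n => ((hφ n).continuous.comp hc).aestronglyMeasurable)
      (fun n => ((hψ n).continuous.comp hc).aestronglyMeasurable) a3 b3

theorem HasTrace.smul {c : ℝ} {u : CellL2 ℓ} {g : FaceL2 ℓ i} (hu : HasTrace i c u g) (k : ℂ) :
    HasTrace i c (k • u) (k • g) := by
  obtain ⟨h1, φ, hφ, ⟨a1, a2⟩, a3⟩ := hu
  refine ⟨h1.smul k, fun n x => k • φ n x, fun n => (hφ n).const_smul k,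
    ⟨tendsto_eLpNorm_smul k a1, fun j => ?_⟩, tendsto_eLpNorm_smul k a3⟩
  rw [weakDeriv_smul h1]
  refine (tendsto_eLpNorm_smul k (a2 j)).congr fun n => ?_
  congr 1
  funext x
  have e : pderiv j (fun x => k • φ n x) x = k • pderiv j (φ n) x := by
    simp only [pderiv]
    rw [fderiv_fun_const_smul ((hφ n).differentiable (by simp) x)]
    rfl
  rw [e]

theorem hasTrace_zero (i : Fin 3) (c : ℝ) : HasTrace i c (0 : CellL2 ℓ) 0 := by
  have z : ∀ {X : Type} [MeasurableSpace X] (μ : Measure X),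
      eLpNorm (fun x => (0 : ℂ) - (0 : Lp ℂ 2 μ) x) 2 μ = 0 := by
    intro X _ μ
    rw [eLpNorm_congr_ae (g := 0), eLpNorm_zero]
    filter_upwards [Lp.coeFn_zero ℂ 2 μ] with x hx
    rw [hx]
    simp
  refine ⟨memH1_zero, fun _ _ => 0, fun _ => contDiff_const, ⟨?_, fun j => ?_⟩, ?_⟩
  · simp only [z]
    exact tendsto_const_nhds
  · have e : ∀ x, pderiv j (fun _ : Fin 3 → ℝ => (0 : ℂ)) x = 0 := by simp [pderiv]
    simp only [e, weakDeriv_zero, z]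
    exact tendsto_const_nhds
  · simp only [z]
    exact tendsto_const_nhds

theorem MemFormDomain.add {u v : CellL2 ℓ} (hu : MemFormDomain u) (hv : MemFormDomain v) :
    MemFormDomain (u + v) :=
  ⟨hu.1.add hv.1, by simpa using hu.2.1.add hv.2.1, by simpa using hu.2.2.add hv.2.2⟩

theorem MemFormDomain.smul {u : CellL2 ℓ} (hu : MemFormDomain u) (c : ℂ) :
    MemFormDomain (c • u) :=
  ⟨hu.1.smul c, by simpa using hu.2.1.smul c, by simpa using hu.2.2.smul c⟩

theorem cellForm_self (u : CellL2 ℓ) :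
    cellForm u u = ∑ i, ((∫ x, ‖weakDeriv i u x‖ ^ 2 ∂(cellMeasure ℓ) : ℝ) : ℂ) := by
  simp only [cellForm, L2.inner_def]
  refine Finset.sum_congr rfl fun i _ => ?_
  rw [← integral_complex_ofReal]
  refine integral_congr_ae (Eventually.of_forall fun x => ?_)
  simp [inner_self_eq_norm_sq_to_K]

theorem memFormDomain_zero : MemFormDomain (0 : CellL2 ℓ) :=
  ⟨memH1_zero, hasTrace_zero _ _, hasTrace_zero _ _⟩

end helpers

/-- The graph of the operator associated with the form: the pairs `(u, f)` with `u` in the form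
domain and `cellForm u v = ⟪f, v⟫` for all `v` in the form domain. -/
def formGraph (ℓ : Fin 3 → ℝ) : Submodule ℂ (CellL2 ℓ × CellL2 ℓ) where
  carrier := {p | MemFormDomain p.1 ∧
    ∀ v : CellL2 ℓ, MemFormDomain v → cellForm p.1 v = ⟪p.2, v⟫_ℂ}
  add_mem' := by
    rintro p q ⟨hp, hp'⟩ ⟨hq, hq'⟩
    refine ⟨hp.add hq, fun v hv => ?_⟩
    rw [Prod.snd_add, inner_add_left, ← hp' v hv, ← hq' v hv]
    simp only [cellForm, Prod.fst_add, weakDeriv_add hp.1 hq.1, inner_add_left,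
      Finset.sum_add_distrib]
  zero_mem' := by
    refine ⟨memFormDomain_zero, fun v _ => ?_⟩
    simp [cellForm, weakDeriv_zero]
  smul_mem' := by
    rintro c p ⟨hp, hp'⟩
    refine ⟨hp.smul c, fun v hv => ?_⟩
    rw [Prod.smul_snd, inner_smul_left, ← hp' v hv]
    simp only [cellForm, Prod.smul_fst, weakDeriv_smul hp.1, inner_smul_left, Finset.mul_sum]

/-- The unbounded operator in `L²` of the cell associated with the form `cellForm` on its form
domain. -/
def cellOperator (ℓ : Fin 3 → ℝ) : CellL2 ℓ →ₗ.[ℂ] CellL2 ℓ :=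
  (formGraph ℓ).toLinearPMap

/-- Neumann conditions on the lateral faces (vanishing trace of the normal derivative on `x = 0`,
`x = ℓ 0`, `y = 0`, `y = ℓ 1`) and Dirichlet conditions on the plate faces (vanishing trace on
`z = 0`, `z = ℓ 2`), for an `H²` function. -/
def MixedBoundaryConditions {ℓ : Fin 3 → ℝ} (u : CellL2 ℓ) : Prop :=
  (HasTrace 0 0 (weakDeriv 0 u) 0 ∧ HasTrace 0 (ℓ 0) (weakDeriv 0 u) 0) ∧
  (HasTrace 1 0 (weakDeriv 1 u) 0 ∧ HasTrace 1 (ℓ 1) (weakDeriv 1 u) 0) ∧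
  (HasTrace 2 0 u 0 ∧ HasTrace 2 (ℓ 2) u 0)

/-- The eigenspace `{u ∈ dom A | A u = μ u}` of an unbounded operator. -/
def eigenspace {E : Type*} [AddCommGroup E] [Module ℂ E] (A : E →ₗ.[ℂ] E) (μ : ℂ) :
    Submodule ℂ E :=
  A.graph.comap (LinearMap.id.prod (μ • LinearMap.id))

/-- `π² m² / ℓ₁² + π² n² / ℓ₂² + π² r² / a²`. -/
def cellEigenvalue (ℓ₁ ℓ₂ a : ℝ) (m n r : ℕ) : ℝ :=
  Real.pi ^ 2 * (m : ℝ) ^ 2 / ℓ₁ ^ 2 + Real.pi ^ 2 * (n : ℝ) ^ 2 / ℓ₂ ^ 2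
    + Real.pi ^ 2 * (r : ℝ) ^ 2 / a ^ 2

end

end MixedCell

namespace MixedCell

noncomputable section

/-! Everything is read off Fourier coefficients. Let `e_p` be the normalised product of cosines in
the two lateral directions and a sine in the direction orthogonal to the plates, and `λ_p` the sum
of its squared frequencies. The central fact (`isDiagonalGraph_formGraph`) is that `(u, f)` lies in
the graph of the form operator exactly when `⟪e_p, f⟫ = λ_p ⟪e_p, u⟫` for every `p`. As the `λ_p`
are real and nonnegative and each value is taken finitely often, self-adjointness, positivity and
the eigenvalue count are then statements about diagonal operators in a Hilbert basis.

From the form to the coefficients, one integrates by parts against `e_p`. Two versions are needed: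
either the smooth function vanishes on both faces (`IsWeakDeriv.integral_pderiv_smul`, by cutoffs,
with no trace of `u`), or the Sobolev function has zero trace there
(`integral_pderiv_smul_of_hasTrace`, by approximation and the divergence theorem). In each direction
exactly one of them applies.

From the coefficients back, `f ∈ L²` forces `∑ (1 + λ_p²) |⟪e_p, u⟫|² < ∞`. The derivatives of the
modes are again pairwise orthogonal, with norms controlled by `λ_p`, so the expansion may be
differentiated twice term by term. Hence `u` is in `H²`, and the boundary conditions pass from the
partial sums to `u`.

Completeness of the modes (`eq_zero_of_inner_cellMode`) comes from Stone–Weierstrass for cosines,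
after multiplication by the lowest sine, which is positive in the cell. -/

open Classical in
/-- The class in `L²` of the cell of a function defined on the whole space (`0` if the function
is not square integrable on the cell). -/
def cellLp (ℓ : Fin 3 → ℝ) (φ : (Fin 3 → ℝ) → ℂ) : CellL2 ℓ :=
  if h : MemLp φ 2 (cellMeasure ℓ) then h.toLp φ else 0

/-! ### Smooth functions as elements of `L²`, and their weak derivatives -/

section cellLp

variable {ℓ : Fin 3 → ℝ} {i : Fin 3}

theorem box_subset_Icc (ℓ : Fin 3 → ℝ) : box ℓ ⊆ Icc 0 ℓ := fun _ hx =>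
  ⟨fun i => (hx i trivial).1.le, fun i => (hx i trivial).2.le⟩

theorem ae_mem_box (ℓ : Fin 3 → ℝ) : ∀ᵐ x ∂(cellMeasure ℓ), x ∈ box ℓ :=
  ae_restrict_mem (isOpen_box ℓ).measurableSet

theorem exists_bound_on_box {F : Type*} [NormedAddCommGroup F] {φ : (Fin 3 → ℝ) → F}
    (h : Continuous φ) (ℓ : Fin 3 → ℝ) : ∃ C, ∀ x ∈ box ℓ, ‖φ x‖ ≤ C := by
  obtain ⟨C, hC⟩ := (isCompact_Icc (a := (0 : Fin 3 → ℝ)) (b := ℓ)).exists_bound_of_continuousOn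
    h.continuousOn
  exact ⟨C, fun x hx => hC x (box_subset_Icc ℓ hx)⟩

theorem memLp_of_continuous {φ : (Fin 3 → ℝ) → ℂ} (h : Continuous φ) :
    MemLp φ 2 (cellMeasure ℓ) := by
  obtain ⟨C, hC⟩ := exists_bound_on_box h ℓ
  refine MemLp.of_bound h.aestronglyMeasurable C ?_
  filter_upwards [ae_mem_box ℓ] with x hx using hC x hx

theorem cellLp_ae {φ : (Fin 3 → ℝ) → ℂ} (h : Continuous φ) :
    cellLp ℓ φ =ᵐ[cellMeasure ℓ] φ := by
  rw [cellLp, dif_pos (memLp_of_continuous h)]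
  exact MemLp.coeFn_toLp _

theorem cellLp_add {φ ψ : (Fin 3 → ℝ) → ℂ} (h : Continuous φ) (h' : Continuous ψ) :
    cellLp ℓ (fun x => φ x + ψ x) = cellLp ℓ φ + cellLp ℓ ψ := by
  apply Lp.ext
  filter_upwards [cellLp_ae (ℓ := ℓ) (φ := fun x => φ x + ψ x) (h.add h'), cellLp_ae (ℓ := ℓ) h, cellLp_ae (ℓ := ℓ) h',
    Lp.coeFn_add (cellLp ℓ φ) (cellLp ℓ ψ)] with x h1 h2 h3 h4
  rw [h4, Pi.add_apply, h1, h2, h3]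

theorem cellLp_smul {φ : (Fin 3 → ℝ) → ℂ} (h : Continuous φ) (c : ℂ) :
    cellLp ℓ (fun x => c • φ x) = c • cellLp ℓ φ := by
  apply Lp.ext
  filter_upwards [cellLp_ae (ℓ := ℓ) (φ := fun x => c • φ x) (h.const_smul c), cellLp_ae (ℓ := ℓ) h,
    Lp.coeFn_smul c (cellLp ℓ φ)] with x h1 h2 h4
  rw [h4, Pi.smul_apply, h1, h2]

theorem cellLp_sum {ι : Type*} {f : ι → (Fin 3 → ℝ) → ℂ} (h : ∀ k, Continuous (f k))
    (c : ι → ℂ) (s : Finset ι) :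
    cellLp ℓ (fun x => ∑ k ∈ s, c k • f k x) = ∑ k ∈ s, c k • cellLp ℓ (f k) := by
  classical
  induction s using Finset.induction_on with
  | empty =>
    have := cellLp_smul (ℓ := ℓ) (φ := fun _ => 0) continuous_const 0
    simpa using this
  | insert k s hk ih =>
    simp only [Finset.sum_insert hk]
    rw [cellLp_add (φ := fun x => c k • f k x) (ψ := fun x => ∑ j ∈ s, c j • f j x)
      ((h k).const_smul (c k))
      (continuous_finsetSum _ fun j _ => (h j).const_smul (c j)), ih, cellLp_smul (h k)]

theorem integrable_smul_cellLp {ψ : (Fin 3 → ℝ) → ℝ} (h : Continuous ψ) (u : CellL2 ℓ) :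
    Integrable (fun x => ψ x • u x) (cellMeasure ℓ) := by
  obtain ⟨C, hC⟩ := exists_bound_on_box h ℓ
  refine ((Lp.memLp u).integrable (by norm_num)).bdd_smul C h.aestronglyMeasurable ?_
  filter_upwards [ae_mem_box ℓ] with x hx using hC x hx

/-- The integral over the cell of a real function against an element of `L²`. -/
theorem inner_cellLp {ψ : (Fin 3 → ℝ) → ℝ} (h : Continuous ψ) (u : CellL2 ℓ) :
    ⟪cellLp ℓ (fun x => (ψ x : ℂ)), u⟫_ℂ = ∫ x, ψ x • u x ∂(cellMeasure ℓ) := by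
  rw [L2.inner_def]
  refine integral_congr_ae ?_
  filter_upwards [cellLp_ae (ℓ := ℓ) (Complex.continuous_ofReal.comp h)] with x hx
  have hx' : cellLp ℓ (fun x => (ψ x : ℂ)) x = (ψ x : ℂ) := hx
  rw [hx', RCLike.inner_apply, Complex.conj_ofReal, mul_comm, Complex.real_smul]

theorem inner_cellLp_cellLp {ψ φ : (Fin 3 → ℝ) → ℝ} (h : Continuous ψ) (h' : Continuous φ) :
    ⟪cellLp ℓ (fun x => (ψ x : ℂ)), cellLp ℓ (fun x => (φ x : ℂ))⟫_ℂ
      = ((∫ x, ψ x * φ x ∂(cellMeasure ℓ) : ℝ) : ℂ) := by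
  rw [inner_cellLp h, ← integral_complex_ofReal]
  refine integral_congr_ae ?_
  filter_upwards [cellLp_ae (ℓ := ℓ) (Complex.continuous_ofReal.comp h')] with x hx
  have hx' : cellLp ℓ (fun x => (φ x : ℂ)) x = (φ x : ℂ) := hx
  simp [hx']

theorem tendsto_cellLp_iff {φ : ℕ → (Fin 3 → ℝ) → ℂ} (h : ∀ n, Continuous (φ n)) (u : CellL2 ℓ) :
    Tendsto (fun n => eLpNorm (fun x => φ n x - u x) 2 (cellMeasure ℓ)) atTop (𝓝 0) ↔
      Tendsto (fun n => cellLp ℓ (φ n)) atTop (𝓝 u) := by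
  rw [Lp.tendsto_Lp_iff_tendsto_eLpNorm']
  refine tendsto_congr fun n => eLpNorm_congr_ae ?_
  filter_upwards [cellLp_ae (ℓ := ℓ) (h n)] with x hx
  simp [hx]

theorem contDiff_pderiv {F : Type*} [NormedAddCommGroup F] [NormedSpace ℝ F]
    {φ : (Fin 3 → ℝ) → F} (h : ContDiff ℝ ∞ φ) (i : Fin 3) : ContDiff ℝ ∞ (pderiv i φ) :=
  (h.fderiv_right (m := ∞) (by simp)).clm_apply contDiff_const

theorem contDiff_ofReal {ψ : (Fin 3 → ℝ) → ℝ} (h : ContDiff ℝ ∞ ψ) :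
    ContDiff ℝ ∞ fun x => (ψ x : ℂ) :=
  Complex.ofRealCLM.contDiff.comp h

theorem pderiv_ofReal {ψ : (Fin 3 → ℝ) → ℝ} (h : ContDiff ℝ ∞ ψ) (i : Fin 3) :
    pderiv i (fun x => (ψ x : ℂ)) = fun x => ((pderiv i ψ x : ℝ) : ℂ) := by
  funext x
  have := (Complex.ofRealCLM.hasFDerivAt (x := ψ x)).comp x
    (h.differentiable (by simp) x).hasFDerivAt
  have e : (fun x => (ψ x : ℂ)) = ⇑Complex.ofRealCLM ∘ ψ := rfl
  rw [pderiv, e, this.fderiv]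
  rfl

theorem pderiv_mul {ψ φ : (Fin 3 → ℝ) → ℝ} (h : ContDiff ℝ ∞ ψ) (h' : ContDiff ℝ ∞ φ)
    (i : Fin 3) (x : Fin 3 → ℝ) :
    pderiv i (fun x => ψ x * φ x) x = pderiv i ψ x * φ x + ψ x * pderiv i φ x := by
  have := (h.differentiable (by simp) x).hasFDerivAt.fun_mul
    (h'.differentiable (by simp) x).hasFDerivAt
  rw [pderiv, this.fderiv]
  simp only [pderiv, add_apply, smul_apply, smul_eq_mul]
  ring

theorem pderiv_smul {ψ : (Fin 3 → ℝ) → ℝ} {f : (Fin 3 → ℝ) → ℂ} (h : ContDiff ℝ ∞ ψ)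
    (h' : ContDiff ℝ ∞ f) (i : Fin 3) (x : Fin 3 → ℝ) :
    pderiv i (fun x => ψ x • f x) x = pderiv i ψ x • f x + ψ x • pderiv i f x := by
  have := (h.differentiable (by simp) x).hasFDerivAt.fun_smul
    (h'.differentiable (by simp) x).hasFDerivAt
  rw [pderiv, this.fderiv]
  simp [pderiv, add_comm]

theorem pderiv_eq_of_hasDerivAt {F : Type*} [NormedAddCommGroup F] [NormedSpace ℝ F]
    {φ : (Fin 3 → ℝ) → F} {x : Fin 3 → ℝ} {d : F} (h : DifferentiableAt ℝ φ x) (i : Fin 3)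
    (hd : HasDerivAt (fun t => φ (Function.update x i t)) d (x i)) : pderiv i φ x = d := by
  have h1 : HasFDerivAt φ (fderiv ℝ φ x) (Function.update x i (x i)) := by
    rw [Function.update_eq_self]
    exact h.hasFDerivAt
  exact (h1.comp_hasDerivAt (x i) (hasDerivAt_update x i (x i))).unique hd

theorem pderiv_sum_smul {ι : Type*} {f : ι → (Fin 3 → ℝ) → ℂ} (h : ∀ k, ContDiff ℝ ∞ (f k))
    (c : ι → ℂ) (s : Finset ι) (i : Fin 3) :
    pderiv i (fun x => ∑ k ∈ s, c k • f k x) = fun x => ∑ k ∈ s, c k • pderiv i (f k) x := by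
  funext x
  have := HasFDerivAt.fun_sum (u := s) fun k _ =>
    (((h k).differentiable (by simp) x).hasFDerivAt.fun_const_smul (c k))
  rw [pderiv, this.fderiv]
  simp [pderiv]

theorem isWeakDeriv_iff_inner {u w : CellL2 ℓ} : IsWeakDeriv i u w ↔
    ∀ φ : (Fin 3 → ℝ) → ℝ, ContDiff ℝ ∞ φ → HasCompactSupport φ → tsupport φ ⊆ box ℓ →
      ⟪cellLp ℓ (fun x => ((pderiv i φ x : ℝ) : ℂ)), u⟫_ℂ = - ⟪cellLp ℓ (fun x => (φ x : ℂ)), w⟫_ℂ := by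
  refine forall_congr' fun φ => forall_congr' fun hφ => ?_
  rw [inner_cellLp (contDiff_pderiv hφ i).continuous, inner_cellLp hφ.continuous]

/-- Weak differentiation is a closed relation: each test function imposes an identity between inner
products with fixed vectors, which survives `L²` limits. -/
theorem IsWeakDeriv.of_tendsto {α : Type*} {F : Filter α} [F.NeBot] {u w : CellL2 ℓ}
    {U W : α → CellL2 ℓ} (h : ∀ n, IsWeakDeriv i (U n) (W n)) (hu : Tendsto U F (𝓝 u))
    (hw : Tendsto W F (𝓝 w)) : IsWeakDeriv i u w := by
  rw [isWeakDeriv_iff_inner]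
  intro φ h1 h2 h3
  refine tendsto_nhds_unique (tendsto_const_nhds.inner hu) ?_
  refine (tendsto_const_nhds.inner hw).neg.congr fun n => ?_
  exact (isWeakDeriv_iff_inner.1 (h n) φ h1 h2 h3).symm

/-- A function which is smooth on the whole space has its classical derivative as weak
derivative. -/
theorem isWeakDeriv_cellLp {f : (Fin 3 → ℝ) → ℂ} (hf : ContDiff ℝ ∞ f) (i : Fin 3) :
    IsWeakDeriv i (cellLp ℓ f) (cellLp ℓ (pderiv i f)) := by
  intro φ hφ hs ht
  -- All integrands are carried by the support of `φ`, inside the cell, so integrals over the cell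
  -- become integrals over the whole space, where no boundary term appears.
  have hsub : ∀ {χ : (Fin 3 → ℝ) → ℝ} {g : (Fin 3 → ℝ) → ℂ}, tsupport χ ⊆ tsupport φ →
      ∫ x, χ x • g x ∂(cellMeasure ℓ) = ∫ x, χ x • g x := by
    intro χ g hχ
    refine setIntegral_eq_integral_of_forall_compl_eq_zero fun x hx => ?_
    rw [image_eq_zero_of_notMem_tsupport (fun h => hx (ht (hχ h))), zero_smul]
  have hd : tsupport (pderiv i φ) ⊆ tsupport φ := tsupport_fderiv_apply_subset ℝ _
  have hc := continuous_pderiv hf i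
  have hcφ := (contDiff_pderiv hφ i).continuous
  have hsφ : HasCompactSupport (pderiv i φ) := hs.fderiv_apply (𝕜 := ℝ) _
  have e1 : ∫ x, pderiv i φ x • cellLp ℓ f x ∂(cellMeasure ℓ) = ∫ x, pderiv i φ x • f x := by
    rw [← hsub hd]
    refine integral_congr_ae ?_
    filter_upwards [cellLp_ae (ℓ := ℓ) hf.continuous] with x hx
    rw [hx]
  have e2 : ∫ x, φ x • cellLp ℓ (pderiv i f) x ∂(cellMeasure ℓ) = ∫ x, φ x • pderiv i f x := by
    rw [← hsub subset_rfl]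
    refine integral_congr_ae ?_
    filter_upwards [cellLp_ae (ℓ := ℓ) hc] with x hx
    rw [hx]
  have int1 : Integrable fun x => pderiv i φ x • f x :=
    (hcφ.smul hf.continuous).integrable_of_hasCompactSupport hsφ.smul_right
  have int2 : Integrable fun x => φ x • pderiv i f x :=
    (hφ.continuous.smul hc).integrable_of_hasCompactSupport hs.smul_right
  have int3 : Integrable fun x => φ x • f x :=
    (hφ.continuous.smul hf.continuous).integrable_of_hasCompactSupport hs.smul_right
  rw [e1, e2]
  have := integral_smul_fderiv_eq_neg_fderiv_smul_of_integrable (𝕜 := ℝ) int1 int2 int3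
    (fun x _ => hφ.differentiable (by simp) x) (fun x _ => hf.differentiable (by simp) x)
  simp only [pderiv]
  rw [this, neg_neg]

theorem memH1_cellLp {f : (Fin 3 → ℝ) → ℂ} (hf : ContDiff ℝ ∞ f) : MemH1 (cellLp ℓ f) :=
  fun i => ⟨_, isWeakDeriv_cellLp hf i⟩

theorem weakDeriv_cellLp {f : (Fin 3 → ℝ) → ℂ} (hf : ContDiff ℝ ∞ f) (i : Fin 3) :
    weakDeriv i (cellLp ℓ f) = cellLp ℓ (pderiv i f) :=
  (isWeakDeriv_cellLp hf i).weakDeriv_eq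

/-! ### Term-by-term differentiation and traces of series -/

section series

variable {ι : Type*} {f : ι → (Fin 3 → ℝ) → ℂ} {c : ι → ℂ} {u : CellL2 ℓ}

theorem _root_.HasSum.comp_seq {E : Type*} [AddCommMonoid E] [TopologicalSpace E] {g : ι → E} {a : E}
    (h : HasSum g a) {s : ℕ → Finset ι} (hs : Tendsto s atTop atTop) :
    Tendsto (fun n => ∑ k ∈ s n, g k) atTop (𝓝 a) :=
  Tendsto.comp (g := fun t : Finset ι => ∑ k ∈ t, g k) h hs

theorem isWeakDeriv_of_hasSum (hf : ∀ k, ContDiff ℝ ∞ (f k)) {w : CellL2 ℓ}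
    (hu : HasSum (fun k => c k • cellLp ℓ (f k)) u)
    (hw : HasSum (fun k => c k • cellLp ℓ (pderiv i (f k))) w) : IsWeakDeriv i u w := by
  refine IsWeakDeriv.of_tendsto (fun s => ?_) hu hw
  have h1 := isWeakDeriv_cellLp (ℓ := ℓ) (f := fun x => ∑ k ∈ s, c k • f k x)
    (ContDiff.sum fun k _ => (hf k).const_smul (c k)) i
  rwa [pderiv_sum_smul hf, cellLp_sum fun k => (hf k).continuous,
    cellLp_sum fun k => continuous_pderiv (hf k) i] at h1

/-- The sum of an `H¹`-convergent series of smooth functions vanishing on a face has trace `0`. -/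
theorem hasTrace_zero_of_hasSum [Countable ι] (hf : ∀ k, ContDiff ℝ ∞ (f k)) {w : Fin 3 → CellL2 ℓ}
    (hu : HasSum (fun k => c k • cellLp ℓ (f k)) u)
    (hw : ∀ j, HasSum (fun k => c k • cellLp ℓ (pderiv j (f k))) (w j)) {b : ℝ}
    (hb : ∀ k x, x i = b → f k x = 0) : HasTrace i b u 0 := by
  have hW := fun j => isWeakDeriv_of_hasSum hf hu (hw j)
  -- A trace is witnessed by a sequence, while the sum converges along the filter of finite sets;
  -- for a countable index set some sequence of finite sets is cofinal.
  obtain ⟨s, hs⟩ := exists_seq_tendsto (atTop : Filter (Finset ι))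
  have hsm : ∀ n, ContDiff ℝ ∞ fun x => ∑ k ∈ s n, c k • f k x := fun n =>
    ContDiff.sum fun k _ => (hf k).const_smul (c k)
  refine ⟨fun j => ⟨_, hW j⟩, fun n x => ∑ k ∈ s n, c k • f k x, hsm, ⟨?_, fun j => ?_⟩, ?_⟩
  · rw [tendsto_cellLp_iff fun n => (hsm n).continuous]
    simp only [cellLp_sum fun k => (hf k).continuous]
    exact hu.comp_seq hs
  · rw [tendsto_cellLp_iff fun n => continuous_pderiv (hsm n) j]
    simp only [pderiv_sum_smul hf, cellLp_sum fun k => continuous_pderiv (hf k) j,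
      (hW j).weakDeriv_eq]
    exact (hw j).comp_seq hs
  · refine tendsto_const_nhds.congr fun n => ?_
    symm
    rw [← eLpNorm_zero (α := Fin 2 → ℝ) (ε := ℂ) (p := 2) (μ := faceMeasure ℓ i)]
    refine eLpNorm_congr_ae ?_
    filter_upwards [Lp.coeFn_zero ℂ 2 (faceMeasure ℓ i)] with y hy
    rw [hy]
    simp [hb]

end series

end cellLp

/-! ### One-dimensional cutoffs with uniform control near the end points -/

/-- A smooth cutoff function on the interval `(0, L)`, equal to `1` at distance more than `2 / n`
from the end points and to `0` at distance less than `1 / n` from them. -/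
def cutoff (L : ℝ) (n : ℕ) (t : ℝ) : ℝ :=
  Real.smoothTransition (n * t - 1) * Real.smoothTransition (n * (L - t) - 1)

section cutoff

variable {L : ℝ} {n : ℕ} {t : ℝ}

theorem contDiff_cutoff (L : ℝ) (n : ℕ) : ContDiff ℝ ∞ (cutoff L n) :=
  (Real.smoothTransition.contDiff.comp (by fun_prop)).mul
    (Real.smoothTransition.contDiff.comp (by fun_prop))

theorem cutoff_nonneg : 0 ≤ cutoff L n t :=
  mul_nonneg (Real.smoothTransition.nonneg _) (Real.smoothTransition.nonneg _)

theorem cutoff_le_one : cutoff L n t ≤ 1 :=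
  mul_le_one₀ (Real.smoothTransition.le_one _) (Real.smoothTransition.nonneg _)
    (Real.smoothTransition.le_one _)

theorem one_le_of_cutoff_ne_zero (h : cutoff L n t ≠ 0) : 1 ≤ n * t ∧ 1 ≤ n * (L - t) := by
  constructor <;> by_contra! hc <;> apply h
  · rw [cutoff, Real.smoothTransition.zero_of_nonpos (by linarith), zero_mul]
  · rw [cutoff, Real.smoothTransition.zero_of_nonpos (x := n * (L - t) - 1) (by linarith), mul_zero]

theorem eventually_cutoff_eq_one (h : t ∈ Ioo 0 L) :
    ∀ᶠ n in atTop, ∀ᶠ s in 𝓝 t, cutoff L n s = 1 := by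
  have h1 : ∀ᶠ n : ℕ in atTop, 2 < n * t :=
    (tendsto_natCast_atTop_atTop.atTop_mul_const h.1).eventually_gt_atTop 2
  have h2 : ∀ᶠ n : ℕ in atTop, 2 < n * (L - t) :=
    (tendsto_natCast_atTop_atTop.atTop_mul_const (sub_pos.2 h.2)).eventually_gt_atTop 2
  filter_upwards [h1, h2] with n h1 h2
  have c1 : ContinuousAt (fun s : ℝ => (n : ℝ) * s) t := by fun_prop
  have c2 : ContinuousAt (fun s : ℝ => (n : ℝ) * (L - s)) t := by fun_prop
  filter_upwards [c1.eventually (lt_mem_nhds h1), c2.eventually (lt_mem_nhds h2)] with s hs1 hs2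
  rw [cutoff, Real.smoothTransition.one_of_one_le (by linarith),
    Real.smoothTransition.one_of_one_le (by linarith), mul_one]

/-- The transition is constant on either side of `[0, 1]`, so its continuous derivative need only be
bounded there. The vanishing beyond `1` confines the derivative of the cutoff to distance `2 / n`
from the end points. -/
theorem exists_bound_deriv_smoothTransition :
    ∃ B, 0 ≤ B ∧ ∀ t, |deriv Real.smoothTransition t| ≤ B ∧
      (1 < t → deriv Real.smoothTransition t = 0) := by
  have hc : Continuous (deriv Real.smoothTransition) :=
    (Real.smoothTransition.contDiff (n := 1)).continuous_deriv le_rfl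
  obtain ⟨B, hB⟩ := (isCompact_Icc (a := (0 : ℝ)) (b := 1)).exists_bound_of_continuousOn
    hc.continuousOn
  have h1 : ∀ t, 1 < t → deriv Real.smoothTransition t = 0 := by
    intro t ht
    have : Real.smoothTransition =ᶠ[𝓝 t] fun _ => 1 := by
      filter_upwards [lt_mem_nhds ht] with s hs using Real.smoothTransition.one_of_one_le hs.le
    rw [this.deriv_eq, deriv_const]
  have h0 : ∀ t, t < 0 → deriv Real.smoothTransition t = 0 := by
    intro t ht
    have : Real.smoothTransition =ᶠ[𝓝 t] fun _ => 0 := by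
      filter_upwards [gt_mem_nhds ht] with s hs using Real.smoothTransition.zero_of_nonpos hs.le
    rw [this.deriv_eq, deriv_const]
  have hB0 : 0 ≤ B := (norm_nonneg _).trans (hB 0 (by simp))
  refine ⟨B, hB0, fun t => ⟨?_, h1 t⟩⟩
  rcases lt_or_ge t 0 with ht | ht
  · rw [h0 t ht, abs_zero]
    exact hB0
  rcases lt_or_ge 1 t with ht' | ht'
  · rw [h1 t ht', abs_zero]
    exact hB0
  · exact hB t ⟨ht, ht'⟩

theorem hasDerivAt_cutoff (L : ℝ) (n : ℕ) (t : ℝ) :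
    HasDerivAt (cutoff L n) (n * deriv Real.smoothTransition (n * t - 1) *
      Real.smoothTransition (n * (L - t) - 1) - Real.smoothTransition (n * t - 1) *
        (n * deriv Real.smoothTransition (n * (L - t) - 1))) t := by
  have hs : ∀ s, HasDerivAt Real.smoothTransition (deriv Real.smoothTransition s) s := fun s =>
    ((Real.smoothTransition.contDiff (n := 1)).differentiable one_ne_zero s).hasDerivAt
  have h1 : HasDerivAt (fun t : ℝ => (n : ℝ) * t - 1) (n * 1) t :=
    ((hasDerivAt_id t).const_mul _).sub_const 1
  have h2 : HasDerivAt (fun t : ℝ => (n : ℝ) * (L - t) - 1) (n * -1) t :=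
    (((hasDerivAt_id t).const_sub L).const_mul _).sub_const 1
  convert! ((hs _).comp t h1).mul ((hs _).comp t h2) using 1
  simp only [Function.comp_apply]
  ring

/-- The derivative of the cutoff has size `n`, but only within `2 / n` of an end point, where a
quantity `p` vanishing linearly there is at most `2 M / n`. The product is thus bounded
independently of `n`; the two end points contribute one term each. -/
theorem exists_bound_deriv_cutoff : ∃ B, 0 ≤ B ∧ ∀ (L : ℝ) (n : ℕ) (t p M : ℝ), 0 < t → t < L →
    0 ≤ M → |p| ≤ M * t → |p| ≤ M * (L - t) → |deriv (cutoff L n) t * p| ≤ B * M := by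
  obtain ⟨B, hB0, hB⟩ := exists_bound_deriv_smoothTransition
  have key : ∀ (n : ℕ) (t p M : ℝ), 0 < t → 0 ≤ M → |p| ≤ M * t →
      n * |deriv Real.smoothTransition (n * t - 1)| * |p| ≤ 2 * B * M := by
    intro n t p M ht hM hp
    rcases lt_or_ge 1 (n * t - 1) with h | h
    · rw [(hB _).2 h]
      simp only [abs_zero, mul_zero, zero_mul]
      positivity
    · calc n * |deriv Real.smoothTransition (n * t - 1)| * |p| ≤ n * B * (M * t) := by
            gcongr
            exact (hB _).1
        _ = B * M * (n * t) := by ring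
        _ ≤ B * M * 2 := by
            gcongr
            linarith
        _ = 2 * B * M := by ring
  refine ⟨4 * B, by positivity, fun L n t p M ht hL hM hp hp' => ?_⟩
  have e : ∀ x, |Real.smoothTransition x| ≤ 1 := fun x => by
    rw [abs_of_nonneg (Real.smoothTransition.nonneg x)]
    exact Real.smoothTransition.le_one x
  have hn : (0 : ℝ) ≤ n := n.cast_nonneg
  rw [(hasDerivAt_cutoff L n t).deriv, abs_mul]
  set A := deriv Real.smoothTransition (n * t - 1)
  set A' := deriv Real.smoothTransition (n * (L - t) - 1)
  have h1 := key n t p M ht hM hp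
  have h2 := key n (L - t) p M (sub_pos.2 hL) hM hp'
  calc _ ≤ (n * |A| * 1 + 1 * (n * |A'|)) * |p| := by
        refine mul_le_mul_of_nonneg_right ((abs_sub _ _).trans ?_) (abs_nonneg p)
        rw [abs_mul, abs_mul, abs_mul, abs_mul, Nat.abs_cast]
        gcongr
        · exact e _
        · exact e _
    _ ≤ 4 * B * M := by linarith

end cutoff

/-! ### Integration by parts against smooth functions vanishing on two opposite faces -/

section integration_by_parts

variable {ℓ : Fin 3 → ℝ} {i : Fin 3}

/-- The product over the coordinates of the one-dimensional cutoff functions. -/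
def boxCutoff (ℓ : Fin 3 → ℝ) (n : ℕ) (x : Fin 3 → ℝ) : ℝ := ∏ j, cutoff (ℓ j) n (x j)

theorem contDiff_boxCutoff (ℓ : Fin 3 → ℝ) (n : ℕ) : ContDiff ℝ ∞ (boxCutoff ℓ n) :=
  contDiff_prod fun j _ => (contDiff_cutoff (ℓ j) n).comp (contDiff_apply ℝ ℝ j)

theorem tsupport_boxCutoff_subset (ℓ : Fin 3 → ℝ) (n : ℕ) : tsupport (boxCutoff ℓ n) ⊆ box ℓ := by
  have h : tsupport (boxCutoff ℓ n) ⊆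
      {x | ∀ j, 1 ≤ n * x j ∧ 1 ≤ n * (ℓ j - x j)} := by
    refine closure_minimal (fun x hx j => ?_) ?_
    · exact one_le_of_cutoff_ne_zero (Finset.prod_ne_zero_iff.1 hx j (Finset.mem_univ j))
    · simp only [Set.ofPred_forall, Set.ofPred_and]
      exact isClosed_iInter fun j => (isClosed_le (by fun_prop) (by fun_prop)).inter
        (isClosed_le (by fun_prop) (by fun_prop))
  intro x hx j _
  obtain ⟨h1, h2⟩ := h hx j
  have hn : (0 : ℝ) ≤ n := n.cast_nonneg
  constructor
  · exact pos_of_mul_pos_right (by linarith) hn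
  · exact sub_pos.1 (pos_of_mul_pos_right (by linarith) hn)

theorem pderiv_boxCutoff (n : ℕ) (x : Fin 3 → ℝ) : pderiv i (boxCutoff ℓ n) x =
    deriv (cutoff (ℓ i) n) (x i) * ∏ j ∈ Finset.univ.erase i, cutoff (ℓ j) n (x j) := by
  refine pderiv_eq_of_hasDerivAt ((contDiff_boxCutoff ℓ n).differentiable (by simp) x) i ?_
  have e : (fun t => boxCutoff ℓ n (Function.update x i t)) =
      fun t => cutoff (ℓ i) n t * ∏ j ∈ Finset.univ.erase i, cutoff (ℓ j) n (x j) := by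
    funext t
    rw [boxCutoff, ← Finset.mul_prod_erase _ _ (Finset.mem_univ i), Function.update_self]
    congr 1
    refine Finset.prod_congr rfl fun j hj => ?_
    rw [Function.update_of_ne (Finset.ne_of_mem_erase hj)]
  rw [e]
  exact (((contDiff_cutoff (ℓ i) n).differentiable (by simp) _).hasDerivAt).mul_const _

/-- Mean value inequality on the segment from `x` to its projection on the hyperplane `x i = c`,
which stays in the convex closed cell. -/
theorem abs_le_mul_sub_of_eq_zero {ψ : (Fin 3 → ℝ) → ℝ} (hψ : ContDiff ℝ ∞ ψ) {M c : ℝ}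
    (hM : ∀ x ∈ Icc 0 ℓ, ‖fderiv ℝ ψ x‖ ≤ M) (hc : c ∈ Icc 0 (ℓ i)) {x : Fin 3 → ℝ}
    (hx : x ∈ box ℓ) (h0 : ψ (Function.update x i c) = 0) : |ψ x| ≤ M * |x i - c| := by
  have hx' := box_subset_Icc ℓ hx
  have hy : Function.update x i c ∈ Icc 0 ℓ :=
    ⟨le_update_iff.2 ⟨hc.1, fun j _ => hx'.1 j⟩, update_le_iff.2 ⟨hc.2, fun j _ => hx'.2 j⟩⟩
  have := (convex_Icc (0 : Fin 3 → ℝ) ℓ).norm_image_sub_le_of_norm_fderiv_le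
    (fun z _ => hψ.differentiable (by simp) z) hM hy hx'
  rw [h0, sub_zero, Real.norm_eq_abs] at this
  refine this.trans_eq ?_
  have e : x - Function.update x i c = Pi.single i (x i - c) := by
    funext j
    rcases eq_or_ne j i with rfl | hj
    · simp
    · simp [hj]
  rw [e, Pi.norm_single, Real.norm_eq_abs]

/-- Integration by parts against a weak derivative for smooth functions vanishing on the two
faces orthogonal to the direction of differentiation. -/
theorem IsWeakDeriv.integral_pderiv_smul {u w : CellL2 ℓ} (h : IsWeakDeriv i u w)
    {ψ : (Fin 3 → ℝ) → ℝ} (hψ : ContDiff ℝ ∞ ψ) (h0 : ∀ x, x i = 0 → ψ x = 0)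
    (h1 : ∀ x, x i = ℓ i → ψ x = 0) :
    ∫ x, pderiv i ψ x • u x ∂(cellMeasure ℓ) = - ∫ x, ψ x • w x ∂(cellMeasure ℓ) := by
  -- Cutting `ψ` off near the whole boundary gives admissible test functions; the identity for `ψ`
  -- follows by dominated convergence.
  set φ : ℕ → (Fin 3 → ℝ) → ℝ := fun n x => boxCutoff ℓ n x * ψ x with hφdef
  have hφ : ∀ n, ContDiff ℝ ∞ (φ n) := fun n => (contDiff_boxCutoff ℓ n).mul hψ
  have hts : ∀ n, tsupport (φ n) ⊆ box ℓ := fun n =>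
    (tsupport_mul_subset_left (f := boxCutoff ℓ n) (g := ψ)).trans (tsupport_boxCutoff_subset ℓ n)
  have hcs : ∀ n, HasCompactSupport (φ n) := fun n =>
    isCompact_Icc.of_isClosed_subset (isClosed_tsupport _) ((hts n).trans (box_subset_Icc ℓ))
  have hev : ∀ x ∈ box ℓ, ∀ᶠ n in atTop, φ n =ᶠ[𝓝 x] ψ := by
    intro x hx
    have : ∀ᶠ n in atTop, ∀ j, ∀ᶠ s in 𝓝 (x j), cutoff (ℓ j) n s = 1 :=
      eventually_all.2 fun j => eventually_cutoff_eq_one (hx j trivial)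
    filter_upwards [this] with n hn
    have hn' : ∀ᶠ y in 𝓝 x, ∀ j, cutoff (ℓ j) n (y j) = 1 :=
      eventually_all.2 fun j => (continuous_apply j).continuousAt.eventually (hn j)
    filter_upwards [hn'] with y hy
    simp [hφdef, boxCutoff, hy]
  obtain ⟨M, hM⟩ := (isCompact_Icc (a := (0 : Fin 3 → ℝ)) (b := ℓ)).exists_bound_of_continuousOn
    (hψ.continuous_fderiv (by simp)).continuousOn
  obtain ⟨B, hB0, hB⟩ := exists_bound_deriv_cutoff
  obtain ⟨C, hC⟩ := exists_bound_on_box hψ.continuous ℓ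
  obtain ⟨D, hD⟩ := exists_bound_on_box (contDiff_pderiv hψ i).continuous ℓ
  have habs : ∀ n x, |boxCutoff ℓ n x| ≤ 1 := fun n x => by
    rw [boxCutoff, Finset.abs_prod]
    refine Finset.prod_le_one (fun j _ => abs_nonneg _) fun j _ => ?_
    rw [abs_of_nonneg cutoff_nonneg]
    exact cutoff_le_one
  -- Only the `i`-th cutoff is differentiated, so its growth must be compensated only near the two
  -- faces orthogonal to `i`, exactly where `ψ` vanishes linearly. Nothing is needed on the other
  -- faces.
  have hnorm : ∀ n, ∀ x ∈ box ℓ, ‖pderiv i (φ n) x‖ ≤ B * M + D := by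
    intro n x hx
    have hxi := hx i trivial
    have hM0 : 0 ≤ M := (norm_nonneg _).trans (hM x (box_subset_Icc ℓ hx))
    have p1 : |ψ x| ≤ M * x i := by
      have := abs_le_mul_sub_of_eq_zero hψ hM (c := 0) (i := i)
        ⟨le_rfl, (hxi.1.trans hxi.2).le⟩ hx (h0 _ (by simp))
      rwa [sub_zero, abs_of_pos hxi.1] at this
    have p2 : |ψ x| ≤ M * (ℓ i - x i) := by
      have := abs_le_mul_sub_of_eq_zero hψ hM (c := ℓ i) (i := i)
        ⟨(hxi.1.trans hxi.2).le, le_rfl⟩ hx (h1 _ (by simp))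
      rwa [abs_sub_comm, abs_of_pos (sub_pos.2 hxi.2)] at this
    rw [hφdef, pderiv_mul (contDiff_boxCutoff ℓ n) hψ, pderiv_boxCutoff]
    refine (norm_add_le _ _).trans (add_le_add ?_ ?_)
    · rw [mul_right_comm, norm_mul]
      refine (mul_le_of_le_one_right (norm_nonneg _) ?_).trans (hB _ n _ _ M hxi.1 hxi.2 hM0 p1 p2)
      rw [Real.norm_eq_abs, Finset.abs_prod]
      refine Finset.prod_le_one (fun j _ => abs_nonneg _) fun j _ => ?_
      rw [abs_of_nonneg cutoff_nonneg]
      exact cutoff_le_one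
    · rw [norm_mul]
      exact (mul_le_of_le_one_left (norm_nonneg _) (habs n x)).trans (hD x hx)
  have int : ∀ v : CellL2 ℓ, Integrable (fun x => ‖v x‖) (cellMeasure ℓ) := fun v =>
    ((Lp.memLp v).integrable (by norm_num)).norm
  have t1 : Tendsto (fun n => ∫ x, pderiv i (φ n) x • u x ∂(cellMeasure ℓ)) atTop
      (𝓝 (∫ x, pderiv i ψ x • u x ∂(cellMeasure ℓ))) := by
    refine tendsto_integral_of_dominated_convergence (fun x => (B * M + D) * ‖u x‖)
      (fun n => (contDiff_pderiv (hφ n) i).continuous.aestronglyMeasurable.smul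
        (Lp.aestronglyMeasurable u)) ((int u).const_mul _) (fun n => ?_) ?_
    · filter_upwards [ae_mem_box ℓ] with x hx
      rw [norm_smul]
      exact mul_le_mul_of_nonneg_right (hnorm n x hx) (norm_nonneg _)
    · filter_upwards [ae_mem_box ℓ] with x hx
      refine tendsto_const_nhds.congr' ?_
      filter_upwards [hev x hx] with n hn
      rw [pderiv, pderiv, hn.fderiv_eq]
  have t2 : Tendsto (fun n => ∫ x, φ n x • w x ∂(cellMeasure ℓ)) atTop
      (𝓝 (∫ x, ψ x • w x ∂(cellMeasure ℓ))) := by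
    refine tendsto_integral_of_dominated_convergence (fun x => C * ‖w x‖)
      (fun n => (hφ n).continuous.aestronglyMeasurable.smul
        (Lp.aestronglyMeasurable w)) ((int w).const_mul _) (fun n => ?_) ?_
    · filter_upwards [ae_mem_box ℓ] with x hx
      rw [norm_smul, norm_mul]
      refine mul_le_mul_of_nonneg_right ?_ (norm_nonneg _)
      exact (mul_le_of_le_one_left (norm_nonneg _) (habs n x)).trans (hC x hx)
    · filter_upwards [ae_mem_box ℓ] with x hx
      refine tendsto_const_nhds.congr' ?_
      filter_upwards [hev x hx] with n hn
      rw [hn.eq_of_nhds]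
  refine tendsto_nhds_unique t1 (t2.neg.congr fun n => ?_)
  exact (h (φ n) (hφ n) (hcs n) (hts n)).symm

end integration_by_parts

/-! ### Integration by parts for functions with zero trace -/

section trace

variable {ℓ : Fin 3 → ℝ} {i : Fin 3}

/-- The divergence theorem on the cell, for a single coordinate direction. -/
theorem integral_pderiv_eq_sub (hℓ : ∀ j, 0 < ℓ j) {g : (Fin 3 → ℝ) → ℂ} (hg : ContDiff ℝ ∞ g)
    (i : Fin 3) : ∫ x, pderiv i g x ∂(cellMeasure ℓ) =
      (∫ y, g (i.insertNth (ℓ i) y) ∂(faceMeasure ℓ i))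
        - ∫ y, g (i.insertNth 0 y) ∂(faceMeasure ℓ i) := by
  classical
  have hc := continuous_pderiv hg i
  have hsum : ∀ x, ∑ j, (if j = i then fderiv ℝ g x else 0) (Pi.single j 1) = pderiv i g x := by
    intro x
    rw [Finset.sum_eq_single i]
    · simp [pderiv]
    · intro j _ hj
      simp [hj]
    · simp
  -- The divergence theorem is applied to the vector field whose only nonzero component is the
  -- `i`-th, equal to `g`.
  have key := integral_divergence_of_hasFDerivAt_off_countable' (0 : Fin 3 → ℝ) ℓ
    (fun j => (hℓ j).le) (fun j => if j = i then g else 0)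
    (fun j x => if j = i then fderiv ℝ g x else 0) ∅ countable_empty
    (fun j => by
      split_ifs
      · exact hg.continuous.continuousOn
      · exact continuousOn_const)
    (fun x _ j => by
      split_ifs
      · exact (hg.differentiable (by simp) x).hasFDerivAt
      · exact hasFDerivAt_const _ _)
    (by
      simp only [hsum]
      exact hc.continuousOn.integrableOn_compact isCompact_Icc)
  simp only [hsum] at key
  rw [Finset.sum_eq_single i (fun j _ hj => by simp [hj]) (by simp)] at key
  simp only [if_true] at key
  have hb : (box ℓ : Set (Fin 3 → ℝ)) =ᵐ[volume] Icc 0 ℓ :=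
    Measure.univ_pi_Ioo_ae_eq_Icc (μ := fun _ => (volume : Measure ℝ))
  have hf : (Set.pi univ fun j => Ioo 0 (ℓ (i.succAbove j)) : Set (Fin 2 → ℝ)) =ᵐ[volume]
      Icc ((0 : Fin 3 → ℝ) ∘ i.succAbove) (ℓ ∘ i.succAbove) :=
    Measure.univ_pi_Ioo_ae_eq_Icc (μ := fun _ => (volume : Measure ℝ))
  rw [setIntegral_congr_set hb, setIntegral_congr_set hf, setIntegral_congr_set hf, key]
  rfl

theorem isFiniteMeasure_faceMeasure (ℓ : Fin 3 → ℝ) (i : Fin 3) :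
    IsFiniteMeasure (faceMeasure ℓ i) := by
  refine ⟨?_⟩
  rw [Measure.restrict_apply_univ]
  refine lt_of_le_of_lt (measure_mono (t := Set.Icc 0 (ℓ ∘ i.succAbove)) ?_)
    isCompact_Icc.measure_lt_top
  intro x hx
  exact ⟨fun i => (hx i trivial).1.le, fun i => (hx i trivial).2.le⟩

theorem memLp_face_of_continuous {φ : (Fin 2 → ℝ) → ℝ} (h : Continuous φ) :
    MemLp φ 2 (faceMeasure ℓ i) := by
  have := isFiniteMeasure_faceMeasure ℓ i
  obtain ⟨C, hC⟩ := (isCompact_Icc (a := (0 : Fin 2 → ℝ))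
    (b := ℓ ∘ i.succAbove)).exists_bound_of_continuousOn h.continuousOn
  refine MemLp.of_bound h.aestronglyMeasurable C ?_
  filter_upwards [ae_restrict_mem (isOpen_set_pi finite_univ
    fun _ _ => isOpen_Ioo).measurableSet] with x hx
  exact hC x ⟨fun i => (hx i trivial).1.le, fun i => (hx i trivial).2.le⟩

theorem tendsto_integral_smul_of_eLpNorm {X : Type*} [MeasurableSpace X] {μ : Measure X}
    {ψ : X → ℝ} (hψ : MemLp ψ 2 μ) {f : ℕ → X → ℂ} (hf : ∀ n, AEStronglyMeasurable (f n) μ)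
    (h : Tendsto (fun n => eLpNorm (f n) 2 μ) atTop (𝓝 0)) :
    Tendsto (fun n => ∫ x, ψ x • f n x ∂μ) atTop (𝓝 0) := by
  rw [tendsto_zero_iff_enorm_tendsto_zero]
  have h' := ENNReal.Tendsto.const_mul (a := eLpNorm ψ 2 μ) h (Or.inr hψ.2.ne)
  rw [mul_zero] at h'
  refine tendsto_of_tendsto_of_tendsto_of_le_of_le tendsto_const_nhds h' (fun _ => zero_le)
    fun n => ?_
  have h1 := enorm_integral_le_lintegral_enorm (μ := μ) fun x => ψ x • f n x
  rw [← eLpNorm_one_eq_lintegral_enorm] at h1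
  have h2 : eLpNorm (ψ • f n) 1 μ ≤ eLpNorm ψ 2 μ * eLpNorm (f n) 2 μ :=
    eLpNorm_smul_le_mul_eLpNorm (p := 2) (q := 2) (hf n) hψ.1
  exact h1.trans h2

/-- Hypothesis `hs` says that only the face at `c` contributes to the boundary term, up to the
factor `s`; this happens when `ψ` vanishes on the opposite face. For the smooth approximants
supplied by the trace, that term tends to `0` by Hölder. Each face is treated alone because each
trace comes with its own approximating sequence. -/
theorem HasTrace.integral_pderiv_smul_of_face {c : ℝ} {u : CellL2 ℓ} (h : HasTrace i c u 0)
    {ψ : (Fin 3 → ℝ) → ℝ} (hψ : ContDiff ℝ ∞ ψ) {s : ℂ}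
    (hs : ∀ f : (Fin 3 → ℝ) → ℂ, ContDiff ℝ ∞ f → ∫ x, pderiv i (fun x => ψ x • f x) x
      ∂(cellMeasure ℓ) = s * ∫ y, ψ (i.insertNth c y) • f (i.insertNth c y) ∂(faceMeasure ℓ i)) :
    ∫ x, pderiv i ψ x • u x ∂(cellMeasure ℓ) = - ∫ x, ψ x • weakDeriv i u x ∂(cellMeasure ℓ) := by
  obtain ⟨-, φ, hφ, ⟨hu, hdu⟩, htr⟩ := h
  have hψ' := contDiff_pderiv hψ i
  rw [tendsto_cellLp_iff fun n => (hφ n).continuous] at hu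
  have hdu := (tendsto_cellLp_iff (fun n => continuous_pderiv (hφ n) i) _).1 (hdu i)
  have hface : Continuous fun y : Fin 2 → ℝ => (i.insertNth c y : Fin 3 → ℝ) := by fun_prop
  have htr' : Tendsto (fun n => s * ∫ y, ψ (i.insertNth c y) • φ n (i.insertNth c y)
      ∂(faceMeasure ℓ i)) atTop (𝓝 (s * 0)) := by
    refine Tendsto.const_mul s (tendsto_integral_smul_of_eLpNorm
      (memLp_face_of_continuous (hψ.continuous.comp hface))
      (fun n => ((hφ n).continuous.comp hface).aestronglyMeasurable) (htr.congr fun n => ?_))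
    refine eLpNorm_congr_ae ?_
    filter_upwards [Lp.coeFn_zero ℂ 2 (faceMeasure ℓ i)] with y hy
    rw [hy, Pi.zero_apply, sub_zero]
  rw [← inner_cellLp hψ'.continuous, ← inner_cellLp hψ.continuous, eq_neg_iff_add_eq_zero]
  rw [mul_zero] at htr'
  refine tendsto_nhds_unique ((tendsto_const_nhds.inner hu).add (tendsto_const_nhds.inner hdu))
    (htr'.congr fun n => ?_)
  rw [← hs (φ n) (hφ n), inner_cellLp hψ'.continuous, inner_cellLp hψ.continuous,
    ← integral_add (integrable_smul_cellLp hψ'.continuous _)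
      (integrable_smul_cellLp hψ.continuous _)]
  refine integral_congr_ae ?_
  filter_upwards [cellLp_ae (ℓ := ℓ) (hφ n).continuous,
    cellLp_ae (ℓ := ℓ) (continuous_pderiv (hφ n) i)] with x h1 h2
  rw [h1, h2, pderiv_smul hψ (hφ n)]

/-- Integration by parts for an `H¹` function with vanishing traces on the two faces orthogonal to
the direction of differentiation, against functions smooth up to the boundary. -/
theorem integral_pderiv_smul_of_hasTrace (hℓ : ∀ j, 0 < ℓ j) {u : CellL2 ℓ} (h0 : HasTrace i 0 u 0)
    (h1 : HasTrace i (ℓ i) u 0) {ψ : (Fin 3 → ℝ) → ℝ} (hψ : ContDiff ℝ ∞ ψ) :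
    ∫ x, pderiv i ψ x • u x ∂(cellMeasure ℓ) = - ∫ x, ψ x • weakDeriv i u x ∂(cellMeasure ℓ) := by
  -- Split `ψ` by the weights `x i / ℓ i` and `1 - x i / ℓ i`: each piece vanishes on one of the two
  -- faces, so only the trace on the other is used.
  have hi : ContDiff ℝ ∞ fun x : Fin 3 → ℝ => x i / ℓ i := (contDiff_apply ℝ ℝ i).div_const _
  have hA : ContDiff ℝ ∞ fun x : Fin 3 → ℝ => x i / ℓ i * ψ x := hi.mul hψ
  have hB : ContDiff ℝ ∞ fun x : Fin 3 → ℝ => (1 - x i / ℓ i) * ψ x :=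
    (contDiff_const.sub hi).mul hψ
  have eA := h1.integral_pderiv_smul_of_face hA (s := 1) fun f hf => by
    rw [integral_pderiv_eq_sub hℓ (g := fun x => (x i / ℓ i * ψ x) • f x) (hA.smul hf) i]
    simp [(hℓ i).ne']
  have eB := h0.integral_pderiv_smul_of_face hB (s := -1) fun f hf => by
    rw [integral_pderiv_eq_sub hℓ (g := fun x => ((1 - x i / ℓ i) * ψ x) • f x) (hB.smul hf) i]
    simp [(hℓ i).ne']
  have hu := fun {χ : (Fin 3 → ℝ) → ℝ} (h : Continuous χ) => integrable_smul_cellLp h u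
  have hw := fun {χ : (Fin 3 → ℝ) → ℝ} (h : Continuous χ) =>
    integrable_smul_cellLp h (weakDeriv i u)
  have e : ψ = fun x => x i / ℓ i * ψ x + (1 - x i / ℓ i) * ψ x := by
    funext x
    ring
  have e' : ∀ x, pderiv i ψ x = pderiv i (fun x => x i / ℓ i * ψ x) x
      + pderiv i (fun x => (1 - x i / ℓ i) * ψ x) x := by
    intro x
    have := (hA.differentiable (by simp) x).hasFDerivAt.fun_add
      (hB.differentiable (by simp) x).hasFDerivAt
    conv_lhs => rw [e, pderiv, this.fderiv]
    rfl
  simp only [e']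
  conv_rhs => rw [e]
  simp only [add_smul]
  rw [integral_add (hu (contDiff_pderiv hA i).continuous) (hu (contDiff_pderiv hB i).continuous),
    integral_add (hw hA.continuous) (hw hB.continuous), eA, eB, neg_add]

end trace

/-! ### Products of sines and cosines: derivatives and orthogonality -/

/-- The sine (for `true`) or the cosine (for `false`). -/
def trig (s : Bool) (t : ℝ) : ℝ := if s then Real.sin t else Real.cos t

/-- The sign in the derivative of `trig`. -/
def trigSign (s : Bool) : ℝ := if s then 1 else -1

theorem trig_false : trig false = Real.cos := by
  funext t
  simp [trig]

theorem trig_true : trig true = Real.sin := by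
  funext t
  simp [trig]

theorem hasDerivAt_trig (s : Bool) (t : ℝ) :
    HasDerivAt (trig s) (trigSign s * trig (!s) t) t := by
  cases s
  · simpa [trig_false, trig_true, trigSign] using Real.hasDerivAt_cos t
  · simpa [trig_false, trig_true, trigSign] using Real.hasDerivAt_sin t

theorem contDiff_trig (s : Bool) : ContDiff ℝ ∞ (trig s) := by
  cases s
  · rw [trig_false]
    exact Real.contDiff_cos
  · rw [trig_true]
    exact Real.contDiff_sin

/-- The frequency `π k / ℓ` in each coordinate direction. -/
def freq (ℓ : Fin 3 → ℝ) (k : Fin 3 → ℕ) (i : Fin 3) : ℝ := Real.pi * k i / ℓ i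

/-- A product of sines and cosines, the kind in each direction being given by `σ`. -/
def mode (ℓ : Fin 3 → ℝ) (σ : Fin 3 → Bool) (k : Fin 3 → ℕ) (x : Fin 3 → ℝ) : ℝ :=
  ∏ i, trig (σ i) (freq ℓ k i * x i)

section mode

variable {ℓ : Fin 3 → ℝ} {i : Fin 3} {σ : Fin 3 → Bool} {k l : Fin 3 → ℕ}

theorem contDiff_mode (ℓ : Fin 3 → ℝ) (σ : Fin 3 → Bool) (k : Fin 3 → ℕ) :
    ContDiff ℝ ∞ (mode ℓ σ k) :=
  contDiff_prod fun j _ => (contDiff_trig (σ j)).comp (contDiff_const.mul (contDiff_apply ℝ ℝ j))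

theorem mode_eq_mul_prod_erase (i : Fin 3) (x : Fin 3 → ℝ) : mode ℓ σ k x =
    trig (σ i) (freq ℓ k i * x i) *
      ∏ j ∈ Finset.univ.erase i, trig (σ j) (freq ℓ k j * x j) :=
  (Finset.mul_prod_erase _ _ (Finset.mem_univ i)).symm

theorem pderiv_mode (i : Fin 3) : pderiv i (mode ℓ σ k) = fun x =>
    trigSign (σ i) * freq ℓ k i * mode ℓ (Function.update σ i (!σ i)) k x := by
  funext x
  refine pderiv_eq_of_hasDerivAt ((contDiff_mode ℓ σ k).differentiable (by simp) x) i ?_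
  have e : (fun t => mode ℓ σ k (Function.update x i t)) = fun t =>
      trig (σ i) (freq ℓ k i * t) * ∏ j ∈ Finset.univ.erase i, trig (σ j) (freq ℓ k j * x j) := by
    funext t
    rw [mode_eq_mul_prod_erase i, Function.update_self]
    congr 1
    refine Finset.prod_congr rfl fun j hj => ?_
    rw [Function.update_of_ne (Finset.ne_of_mem_erase hj)]
  have e' : mode ℓ (Function.update σ i (!σ i)) k x = trig (!σ i) (freq ℓ k i * x i) *
      ∏ j ∈ Finset.univ.erase i, trig (σ j) (freq ℓ k j * x j) := by
    rw [mode_eq_mul_prod_erase i, Function.update_self]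
    congr 1
    refine Finset.prod_congr rfl fun j hj => ?_
    rw [Function.update_of_ne (Finset.ne_of_mem_erase hj)]
  rw [e, e']
  have := ((hasDerivAt_trig (σ i) (freq ℓ k i * x i)).comp (x i)
    ((hasDerivAt_id (x i)).const_mul (freq ℓ k i))).mul_const
      (∏ j ∈ Finset.univ.erase i, trig (σ j) (freq ℓ k j * x j))
  convert! this using 1
  simp only [mul_one]
  ring

theorem pderiv_const_mul {φ : (Fin 3 → ℝ) → ℝ} (h : ContDiff ℝ ∞ φ) (c : ℝ) (i : Fin 3) :
    pderiv i (fun x => c * φ x) = fun x => c * pderiv i φ x := by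
  funext x
  rw [pderiv, ((h.differentiable (by simp) x).hasFDerivAt.const_mul c).fderiv]
  rfl

/-- A scalar multiple of a mode. -/
def scaledMode (ℓ : Fin 3 → ℝ) (c : ℝ) (σ : Fin 3 → Bool) (k : Fin 3 → ℕ) (x : Fin 3 → ℝ) : ℝ :=
  c * mode ℓ σ k x

theorem contDiff_scaledMode (ℓ : Fin 3 → ℝ) (c : ℝ) (σ : Fin 3 → Bool) (k : Fin 3 → ℕ) :
    ContDiff ℝ ∞ (scaledMode ℓ c σ k) :=
  contDiff_const.mul (contDiff_mode ℓ σ k)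

/-- Scaled modes are stable under differentiation, so orthogonality of first derivatives can be
applied again to obtain that of second derivatives. -/
theorem pderiv_scaledMode (i : Fin 3) (c : ℝ) : pderiv i (scaledMode ℓ c σ k) =
    scaledMode ℓ (c * (trigSign (σ i) * freq ℓ k i)) (Function.update σ i (!σ i)) k := by
  funext x
  have := congrFun (pderiv_const_mul (contDiff_mode ℓ σ k) c i) x
  rw [pderiv_mode] at this
  refine this.trans ?_
  rw [scaledMode]
  ring

theorem pderiv_pderiv_scaledMode (i : Fin 3) (c : ℝ) :
    pderiv i (pderiv i (scaledMode ℓ c σ k)) = fun x => - freq ℓ k i ^ 2 * scaledMode ℓ c σ k x := by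
  funext x
  rw [pderiv_scaledMode, pderiv_scaledMode]
  have : trigSign (!σ i) = - trigSign (σ i) ∧ trigSign (σ i) ^ 2 = 1 := by
    cases σ i <;> simp [trigSign]
  simp only [Function.update_self, Function.update_idem, Bool.not_not, Function.update_eq_self,
    scaledMode, this.1]
  linear_combination (- c * freq ℓ k i ^ 2 * mode ℓ σ k x) * this.2

theorem scaledMode_eq_zero (hℓ : ∀ j, 0 < ℓ j) (hσ : σ i = true) (c : ℝ) {x : Fin 3 → ℝ}
    (hx : x i = 0 ∨ x i = ℓ i) : scaledMode ℓ c σ k x = 0 := by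
  rw [scaledMode, mode, Finset.prod_eq_zero (Finset.mem_univ i), mul_zero]
  rcases hx with hx | hx
  · simp [hσ, hx, trig]
  · have : freq ℓ k i * x i = k i * Real.pi := by
      rw [freq, hx, div_mul_cancel₀ _ (hℓ i).ne', mul_comm]
    simp [hσ, this, trig, Real.sin_nat_mul_pi]

theorem pderiv_scaledMode_eq_zero (hℓ : ∀ j, 0 < ℓ j) (hσ : σ i = false) (c : ℝ) {x : Fin 3 → ℝ}
    (hx : x i = 0 ∨ x i = ℓ i) : pderiv i (scaledMode ℓ c σ k) x = 0 := by
  rw [pderiv_scaledMode]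
  exact scaledMode_eq_zero hℓ (by simp [hσ]) _ hx

theorem integrable_of_continuous {φ : (Fin 3 → ℝ) → ℝ} (h : Continuous φ) :
    Integrable φ (cellMeasure ℓ) :=
  (h.continuousOn.integrableOn_compact (isCompact_Icc (a := 0) (b := ℓ))).mono_set
    (box_subset_Icc ℓ)

/-- Green's formula for real functions whose product vanishes on the two faces orthogonal to the
direction of differentiation. -/
theorem integral_pderiv_mul (hℓ : ∀ j, 0 < ℓ j) {φ ψ : (Fin 3 → ℝ) → ℝ} (hφ : ContDiff ℝ ∞ φ)
    (hψ : ContDiff ℝ ∞ ψ) (h : ∀ x, x i = 0 ∨ x i = ℓ i → φ x * ψ x = 0) :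
    ∫ x, pderiv i φ x * ψ x ∂(cellMeasure ℓ) = - ∫ x, φ x * pderiv i ψ x ∂(cellMeasure ℓ) := by
  have key := integral_pderiv_eq_sub hℓ (contDiff_ofReal (hφ.mul hψ)) i
  rw [pderiv_ofReal (hφ.mul hψ)] at key
  have h0 : ∀ y : Fin 2 → ℝ, φ (i.insertNth 0 y) * ψ (i.insertNth 0 y) = 0 := fun y =>
    h _ (Or.inl (by simp))
  have h1 : ∀ y : Fin 2 → ℝ, φ (i.insertNth (ℓ i) y) * ψ (i.insertNth (ℓ i) y) = 0 := fun y =>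
    h _ (Or.inr (by simp))
  simp only [h0, h1, Complex.ofReal_zero, integral_zero,
    sub_zero] at key
  rw [integral_complex_ofReal, Complex.ofReal_eq_zero] at key
  simp only [pderiv_mul hφ hψ] at key
  have i1 : Integrable (fun x => pderiv i φ x * ψ x) (cellMeasure ℓ) :=
    integrable_of_continuous ((contDiff_pderiv hφ i).continuous.mul hψ.continuous)
  have i2 : Integrable (fun x => φ x * pderiv i ψ x) (cellMeasure ℓ) :=
    integrable_of_continuous (hφ.continuous.mul (contDiff_pderiv hψ i).continuous)
  rw [integral_add i1 i2] at key
  exact eq_neg_of_add_eq_zero_left key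

/-- Green's formula without boundary term: on the faces orthogonal to `i`, a sine factor kills the
first function and a cosine factor kills the derivative of the second. -/
theorem integral_pderiv_mul_pderiv (hℓ : ∀ j, 0 < ℓ j) (i : Fin 3) (c d : ℝ) :
    ∫ x, pderiv i (scaledMode ℓ c σ k) x * pderiv i (scaledMode ℓ d σ l) x ∂(cellMeasure ℓ)
      = freq ℓ l i ^ 2 * ∫ x, scaledMode ℓ c σ k x * scaledMode ℓ d σ l x ∂(cellMeasure ℓ) := by
  rw [integral_pderiv_mul hℓ (contDiff_scaledMode ℓ c σ k)
    (contDiff_pderiv (contDiff_scaledMode ℓ d σ l) i), pderiv_pderiv_scaledMode,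
    ← integral_const_mul, ← integral_neg]
  · refine integral_congr_ae (Eventually.of_forall fun x => ?_)
    simp only
    ring
  · intro x hx
    cases hσ : σ i
    · rw [pderiv_scaledMode_eq_zero hℓ hσ d hx, mul_zero]
    · rw [scaledMode_eq_zero hℓ hσ c hx, zero_mul]

/-- The symmetry argument for eigenfunctions: in a direction where `k` and `l` differ, the energy
integral equals the inner product times either squared frequency, and these are distinct. -/
theorem integral_scaledMode_mul_eq_zero (hℓ : ∀ j, 0 < ℓ j) (hkl : k ≠ l) (c d : ℝ) :
    ∫ x, scaledMode ℓ c σ k x * scaledMode ℓ d σ l x ∂(cellMeasure ℓ) = 0 := by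
  obtain ⟨i, hi⟩ := Function.ne_iff.1 hkl
  have h1 := integral_pderiv_mul_pderiv (σ := σ) (k := k) (l := l) hℓ i c d
  have h2 := integral_pderiv_mul_pderiv (σ := σ) (k := l) (l := k) hℓ i d c
  simp only [mul_comm (pderiv i (scaledMode ℓ d σ l) _),
    mul_comm (scaledMode ℓ d σ l _)] at h2
  have h3 : freq ℓ k i ^ 2 ≠ freq ℓ l i ^ 2 := by
    have hf : ∀ m : Fin 3 → ℕ, 0 ≤ freq ℓ m i := fun m =>
      div_nonneg (mul_nonneg Real.pi_pos.le (Nat.cast_nonneg _)) (hℓ i).le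
    rw [Ne, pow_left_inj₀ (hf k) (hf l) two_ne_zero, freq, freq, div_left_inj' (hℓ i).ne',
      mul_right_inj' Real.pi_ne_zero, Nat.cast_inj]
    exact hi
  rw [h1] at h2
  exact (mul_eq_zero.1 (by linear_combination h2 :
    (freq ℓ l i ^ 2 - freq ℓ k i ^ 2) * ∫ x, scaledMode ℓ c σ k x * scaledMode ℓ d σ l x
      ∂(cellMeasure ℓ) = 0)).resolve_left (sub_ne_zero.2 h3.symm)

/-- Normalisation needs only positivity, not the value of the integral; one point of the open cell
where the mode is nonzero suffices. -/
theorem integral_mode_sq_pos (hℓ : ∀ j, 0 < ℓ j) (hk : ∀ i, σ i = true → 0 < k i) :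
    0 < ∫ x, mode ℓ σ k x * mode ℓ σ k x ∂(cellMeasure ℓ) := by
  have hc : Continuous fun x => mode ℓ σ k x * mode ℓ σ k x :=
    (contDiff_mode ℓ σ k).continuous.mul (contDiff_mode ℓ σ k).continuous
  rw [setIntegral_pos_iff_support_of_nonneg_ae
    (Eventually.of_forall fun x => mul_self_nonneg _) (integrable_of_continuous hc)]
  refine IsOpen.measure_pos _ ((isOpen_ne_fun hc continuous_const).inter (isOpen_box ℓ)) ?_
  have hp : ∀ i, (0 : ℝ) < 2 * (k i + 1) := fun i => by positivity
  -- At this point the `i`-th phase is `π / 2 * (k i / (k i + 1))`, which lies in `[0, π / 2)`: the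
  -- cosine is positive there, and so is the sine when `k i > 0`.
  refine ⟨fun i => ℓ i / (2 * (k i + 1)), ?_, fun i _ => ⟨div_pos (hℓ i) (hp i), ?_⟩⟩
  · refine mul_self_ne_zero.2 (Finset.prod_ne_zero_iff.2 fun i _ => ?_)
    have e : freq ℓ k i * (ℓ i / (2 * (k i + 1))) = Real.pi / 2 * (k i / (k i + 1)) := by
      have := (hℓ i).ne'
      rw [freq]
      field_simp
    have h1 : (k i : ℝ) / (k i + 1) < 1 := (div_lt_one (by positivity)).2 (by linarith)
    have h2 : (0 : ℝ) ≤ (k i : ℝ) / (k i + 1) := by positivity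
    have hpi := Real.pi_pos
    have h3 : Real.pi / 2 * (k i / (k i + 1)) < Real.pi / 2 :=
      mul_lt_of_lt_one_right (by positivity) h1
    rw [e]
    cases hσ : σ i
    · simp only [trig]
      refine (Real.cos_pos_of_mem_Ioo ⟨?_, h3⟩).ne'
      have : 0 ≤ Real.pi / 2 * (k i / (k i + 1)) := by positivity
      linarith
    · simp only [trig]
      have hki : (0 : ℝ) < k i := Nat.cast_pos.2 (hk i hσ)
      exact (Real.sin_pos_of_pos_of_lt_pi (by positivity) (by linarith)).ne'
  · refine div_lt_self (hℓ i) ?_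
    have : (0 : ℝ) ≤ k i := Nat.cast_nonneg _
    linarith

end mode

/-! ### The normalised eigenfunctions -/

/-- The triple of frequencies of an index. -/
def modeIndex (p : ℕ × ℕ × ℕ+) : Fin 3 → ℕ := ![p.1, p.2.1, p.2.2]

/-- Cosines in the lateral directions, sines in the direction orthogonal to the plates. -/
def modeKind : Fin 3 → Bool := ![false, false, true]

/-- The normalised eigenfunctions. -/
def cellMode (ℓ : Fin 3 → ℝ) (p : ℕ × ℕ × ℕ+) : (Fin 3 → ℝ) → ℝ :=
  scaledMode ℓ (√(∫ x, mode ℓ modeKind (modeIndex p) x * mode ℓ modeKind (modeIndex p) x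
    ∂(cellMeasure ℓ)))⁻¹ modeKind (modeIndex p)

/-- The frequencies of an eigenfunction. -/
def cellFreq (ℓ : Fin 3 → ℝ) (p : ℕ × ℕ × ℕ+) (i : Fin 3) : ℝ := freq ℓ (modeIndex p) i

section cellMode

variable {ℓ : Fin 3 → ℝ} {p q : ℕ × ℕ × ℕ+}

theorem modeIndex_injective : Function.Injective modeIndex := by
  rintro ⟨m, n, r⟩ ⟨m', n', r'⟩ h
  have h0 := congrFun h 0
  have h1 := congrFun h 1
  have h2 := congrFun h 2
  simp only [modeIndex, Matrix.cons_val] at h0 h1 h2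
  simp [h0, h1, PNat.coe_injective h2]

theorem contDiff_cellMode (ℓ : Fin 3 → ℝ) (p : ℕ × ℕ × ℕ+) : ContDiff ℝ ∞ (cellMode ℓ p) :=
  contDiff_scaledMode _ _ _ _

theorem cellMode_eq_zero (hℓ : ∀ j, 0 < ℓ j) {x : Fin 3 → ℝ} (hx : x 2 = 0 ∨ x 2 = ℓ 2) :
    cellMode ℓ p x = 0 :=
  scaledMode_eq_zero hℓ rfl _ hx

theorem pderiv_cellMode_eq_zero (hℓ : ∀ j, 0 < ℓ j) {i : Fin 3} (hi : i ≠ 2) {x : Fin 3 → ℝ}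
    (hx : x i = 0 ∨ x i = ℓ i) : pderiv i (cellMode ℓ p) x = 0 := by
  refine pderiv_scaledMode_eq_zero hℓ ?_ _ hx
  fin_cases i
  · rfl
  · rfl
  · exact absurd rfl hi

theorem pderiv_pderiv_cellMode (i : Fin 3) : pderiv i (pderiv i (cellMode ℓ p)) =
    fun x => - cellFreq ℓ p i ^ 2 * cellMode ℓ p x :=
  pderiv_pderiv_scaledMode i _

theorem integral_cellMode_mul (hℓ : ∀ j, 0 < ℓ j) :
    ∫ x, cellMode ℓ p x * cellMode ℓ q x ∂(cellMeasure ℓ) = if p = q then 1 else 0 := by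
  split_ifs with h
  · subst h
    have hpos := integral_mode_sq_pos (σ := modeKind) (k := modeIndex p) hℓ (fun i hi => by
      fin_cases i
      · simp [modeKind] at hi
      · simp [modeKind] at hi
      · exact p.2.2.pos)
    simp only [cellMode, scaledMode]
    set I := ∫ x, mode ℓ modeKind (modeIndex p) x * mode ℓ modeKind (modeIndex p) x
      ∂(cellMeasure ℓ)
    have e : ∀ x, (√I)⁻¹ * mode ℓ modeKind (modeIndex p) x *
        ((√I)⁻¹ * mode ℓ modeKind (modeIndex p) x) =
        I⁻¹ * (mode ℓ modeKind (modeIndex p) x * mode ℓ modeKind (modeIndex p) x) := by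
      intro x
      have : I⁻¹ = (√I)⁻¹ * (√I)⁻¹ := by
        rw [← mul_inv, Real.mul_self_sqrt hpos.le]
      rw [this]
      ring
    simp only [e]
    rw [integral_const_mul]
    exact inv_mul_cancel₀ hpos.ne'
  · exact integral_scaledMode_mul_eq_zero hℓ (modeIndex_injective.ne h) _ _

theorem integral_pderiv_cellMode_mul (hℓ : ∀ j, 0 < ℓ j) (i : Fin 3) :
    ∫ x, pderiv i (cellMode ℓ p) x * pderiv i (cellMode ℓ q) x ∂(cellMeasure ℓ)
      = if p = q then cellFreq ℓ p i ^ 2 else 0 := by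
  refine (integral_pderiv_mul_pderiv hℓ i _ _).trans ?_
  have := integral_cellMode_mul (p := p) (q := q) hℓ
  simp only [cellMode] at this
  rw [this]
  split_ifs with h
  · rw [h, mul_one, cellFreq]
  · rw [mul_zero]

theorem integral_pderiv_pderiv_cellMode_mul (hℓ : ∀ j, 0 < ℓ j) (i j : Fin 3) :
    ∫ x, pderiv j (pderiv i (cellMode ℓ p)) x * pderiv j (pderiv i (cellMode ℓ q)) x
      ∂(cellMeasure ℓ) = if p = q then cellFreq ℓ p j ^ 2 * cellFreq ℓ p i ^ 2 else 0 := by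
  have := integral_pderiv_cellMode_mul (p := p) (q := q) hℓ i
  simp only [cellMode, pderiv_scaledMode i] at this ⊢
  rw [integral_pderiv_mul_pderiv hℓ j, this]
  split_ifs with h
  · rw [h]
    rfl
  · rw [mul_zero]

end cellMode

/-! ### Completeness of the eigenfunctions -/

section completeness

variable {ℓ : Fin 3 → ℝ}

/-- Product-to-sum formulas, with frequencies `k + 1` and `k - 1`; the case `k = 0` is separate so
that both stay natural numbers. -/
theorem exists_trig_mul_cos_eq (s : Bool) (k : ℕ) : ∃ (c d : ℝ) (m n : ℕ), ∀ θ : ℝ,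
    trig s θ * Real.cos (k * θ) = c * trig s (m * θ) + d * trig s (n * θ) := by
  rcases k with _ | j
  · exact ⟨1, 0, 1, 0, fun θ => by simp⟩
  · have e : ∀ θ : ℝ, ((j + 1 : ℕ) : ℝ) * θ = j * θ + θ ∧ ((j + 2 : ℕ) : ℝ) * θ = j * θ + θ + θ :=
      fun θ => by
        push_cast
        exact ⟨by ring, by ring⟩
    cases s
    · refine ⟨1 / 2, 1 / 2, j + 2, j, fun θ => ?_⟩
      have : (j : ℝ) * θ = (j * θ + θ) - θ := by ring
      rw [(e θ).1, (e θ).2, trig_false, Real.cos_add (j * θ + θ) θ]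
      nth_rw 4 [this]
      rw [Real.cos_sub]
      ring
    · refine ⟨1 / 2, -1 / 2, j + 2, j, fun θ => ?_⟩
      have : (j : ℝ) * θ = (j * θ + θ) - θ := by ring
      rw [(e θ).1, (e θ).2, trig_true, Real.sin_add (j * θ + θ) θ]
      nth_rw 4 [this]
      rw [Real.sin_sub]
      ring

theorem mode_update {σ : Fin 3 → Bool} {k : Fin 3 → ℕ} (i : Fin 3) (s : Bool) (m : ℕ)
    (x : Fin 3 → ℝ) : mode ℓ (Function.update σ i s) (Function.update k i m) x =
      trig s (m * (Real.pi * x i / ℓ i)) *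
        ∏ j ∈ Finset.univ.erase i, trig (σ j) (freq ℓ k j * x j) := by
  rw [mode_eq_mul_prod_erase i]
  congr 1
  · rw [Function.update_self, freq, Function.update_self]
    congr 1
    ring
  · refine Finset.prod_congr rfl fun j hj => ?_
    have hj' := Finset.ne_of_mem_erase hj
    rw [freq, Function.update_of_ne hj', Function.update_of_ne hj', freq]

theorem exists_trig_mul_mode_eq {σ : Fin 3 → Bool} {i : Fin 3} (hσ : σ i = false) (s : Bool)
    (k : Fin 3 → ℕ) : ∃ (c d : ℝ) (m n : Fin 3 → ℕ), ∀ x,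
      trig s (Real.pi * x i / ℓ i) * mode ℓ σ k x =
        c * mode ℓ (Function.update σ i s) m x + d * mode ℓ (Function.update σ i s) n x := by
  obtain ⟨c, d, m, n, h⟩ := exists_trig_mul_cos_eq s (k i)
  refine ⟨c, d, Function.update k i m, Function.update k i n, fun x => ?_⟩
  rw [mode_update, mode_update, mode_eq_mul_prod_erase i, hσ, trig_false]
  have e : freq ℓ k i * x i = k i * (Real.pi * x i / ℓ i) := by
    rw [freq]
    ring
  rw [e]
  linear_combination (∏ j ∈ Finset.univ.erase i, trig (σ j) (freq ℓ k j * x j)) *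
    h (Real.pi * x i / ℓ i)

/-- Products of cosines, as continuous functions. -/
def cosMode (ℓ : Fin 3 → ℝ) (k : Fin 3 → ℕ) : C(Fin 3 → ℝ, ℝ) :=
  ⟨mode ℓ (fun _ => false) k, (contDiff_mode ℓ _ k).continuous⟩

/-- The lowest nonconstant cosine in each coordinate. -/
def coordCos (ℓ : Fin 3 → ℝ) (i : Fin 3) : C(Fin 3 → ℝ, ℝ) :=
  ⟨fun x => Real.cos (Real.pi * x i / ℓ i), by fun_prop⟩

/-- The induction carries a stronger claim, that multiplication by `f` preserves the span, since
this passes to products; applying it to the constant `1` gives the result. -/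
theorem adjoin_coordCos_le_span (ℓ : Fin 3 → ℝ) {f : C(Fin 3 → ℝ, ℝ)}
    (hf : f ∈ Algebra.adjoin ℝ (range (coordCos ℓ))) :
    f ∈ Submodule.span ℝ (range (cosMode ℓ)) := by
  have key : ∀ g ∈ Submodule.span ℝ (range (cosMode ℓ)),
      f * g ∈ Submodule.span ℝ (range (cosMode ℓ)) := by
    induction hf using Algebra.adjoin_induction with
    | mem f hf =>
      obtain ⟨i, rfl⟩ := hf
      intro g hg
      induction hg using Submodule.span_induction with
      | mem g hg =>
        obtain ⟨k, rfl⟩ := hg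
        obtain ⟨c, d, m, n, h⟩ := exists_trig_mul_mode_eq (ℓ := ℓ) (σ := fun _ => false) (i := i)
          rfl false k
        have hu : Function.update (fun _ : Fin 3 => false) i false = fun _ => false :=
          Function.update_eq_self i _
        rw [hu, trig_false] at h
        have e : coordCos ℓ i * cosMode ℓ k = c • cosMode ℓ m + d • cosMode ℓ n := by
          ext x
          exact h x
        rw [e]
        exact Submodule.add_mem _ (Submodule.smul_mem _ _ (Submodule.subset_span ⟨m, rfl⟩))
          (Submodule.smul_mem _ _ (Submodule.subset_span ⟨n, rfl⟩))
      | zero => simp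
      | add g g' _ _ h h' =>
        rw [mul_add]
        exact Submodule.add_mem _ h h'
      | smul c g _ h =>
        rw [mul_smul_comm]
        exact Submodule.smul_mem _ _ h
    | algebraMap r =>
      intro g hg
      rw [← Algebra.smul_def]
      exact Submodule.smul_mem _ _ hg
    | add f f' _ _ h h' =>
      intro g hg
      rw [add_mul]
      exact Submodule.add_mem _ (h g hg) (h' g hg)
    | mul f f' _ _ h h' =>
      intro g hg
      rw [mul_assoc]
      exact h _ (h' g hg)
  have h1 : (1 : C(Fin 3 → ℝ, ℝ)) ∈ Submodule.span ℝ (range (cosMode ℓ)) := by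
    refine Submodule.subset_span ⟨0, ?_⟩
    ext x
    simp [cosMode, mode, freq, trig_false]
  simpa using key 1 h1

/-- Products of cosines are uniformly dense in the continuous functions on the closed cell. -/
theorem exists_cosMode_span_near (hℓ : ∀ j, 0 < ℓ j) (g : C(Fin 3 → ℝ, ℝ)) {ε : ℝ} (hε : 0 < ε) :
    ∃ f ∈ Submodule.span ℝ (range (cosMode ℓ)), ∀ x ∈ Icc 0 ℓ, |f x - g x| < ε := by
  set ι : C(Icc (0 : Fin 3 → ℝ) ℓ, Fin 3 → ℝ) := ⟨Subtype.val, continuous_subtype_val⟩ with hι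
  set A := (Algebra.adjoin ℝ (range (coordCos ℓ))).map (ContinuousMap.compRightAlgHom ℝ ℝ ι)
    with hA
  -- Cosine is injective on `[0, π]`, so the lowest cosines already tell the points of the closed
  -- cell apart.
  have hsep : A.SeparatesPoints := by
    intro x y hxy
    obtain ⟨i, hi⟩ := Function.ne_iff.1 (Subtype.coe_ne_coe.2 hxy)
    refine ⟨_, ⟨_, ⟨coordCos ℓ i, Algebra.subset_adjoin ⟨i, rfl⟩, rfl⟩, rfl⟩, fun h => hi ?_⟩
    have hmem : ∀ z : Icc (0 : Fin 3 → ℝ) ℓ, Real.pi * z.1 i / ℓ i ∈ Icc 0 Real.pi := by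
      intro z
      have h0 := z.2.1 i
      have h1 := z.2.2 i
      refine ⟨div_nonneg (mul_nonneg Real.pi_pos.le h0) (hℓ i).le, ?_⟩
      rw [div_le_iff₀ (hℓ i)]
      exact mul_le_mul_of_nonneg_left h1 Real.pi_pos.le
    have := Real.injOn_cos (hmem x) (hmem y) h
    rwa [div_left_inj' (hℓ i).ne', mul_right_inj' Real.pi_ne_zero] at this
  obtain ⟨⟨p, f, hf, rfl⟩, hp⟩ := ContinuousMap.exists_mem_subalgebra_near_continuous_of_separatesPoints
    A hsep (g.comp ι) (g.comp ι).continuous ε hε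
  exact ⟨f, adjoin_coordCos_le_span ℓ hf, fun x hx => hp ⟨x, hx⟩⟩

/-- Extends the vanishing to the index `k 2 = 0`, where the sine factor makes the mode identically
zero; the product-to-sum formulas can produce this index. -/
theorem integral_mode_smul_eq_zero {u : CellL2 ℓ} (hℓ : ∀ j, 0 < ℓ j)
    (h : ∀ p, ⟪cellLp ℓ (fun x => (cellMode ℓ p x : ℂ)), u⟫_ℂ = 0) (k : Fin 3 → ℕ) :
    ∫ x, mode ℓ modeKind k x • u x ∂(cellMeasure ℓ) = 0 := by
  rcases Nat.eq_zero_or_pos (k 2) with h2 | h2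
  · have : ∀ x, mode ℓ modeKind k x = 0 := fun x =>
      Finset.prod_eq_zero (Finset.mem_univ 2) (by simp [freq, h2, modeKind, trig_true])
    simp [this]
  · have hp := h (k 0, k 1, ⟨k 2, h2⟩)
    rw [inner_cellLp (contDiff_cellMode ℓ _).continuous] at hp
    have hk : modeIndex (k 0, k 1, ⟨k 2, h2⟩) = k := by
      funext i
      fin_cases i <;> rfl
    simp only [cellMode, scaledMode, hk, mul_smul] at hp
    rw [integral_smul, smul_eq_zero] at hp
    refine hp.resolve_left (inv_ne_zero (Real.sqrt_ne_zero'.2 (integral_mode_sq_pos hℓ ?_)))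
    intro i hi
    fin_cases i
    · simp [modeKind] at hi
    · simp [modeKind] at hi
    · exact h2

/-- The eigenfunctions are complete in `L²` of the cell. -/
theorem eq_zero_of_inner_cellMode (hℓ : ∀ j, 0 < ℓ j) {u : CellL2 ℓ}
    (h : ∀ p, ⟪cellLp ℓ (fun x => (cellMode ℓ p x : ℂ)), u⟫_ℂ = 0) : u = 0 := by
  -- The factor `S` turns products of cosines into combinations of the eigenmodes, so `S u` is
  -- orthogonal to all products of cosines, a uniformly dense system. As `S > 0` in the open cell,
  -- `S u = 0` gives `u = 0`.
  set S : (Fin 3 → ℝ) → ℝ := fun x => Real.sin (Real.pi * x 2 / ℓ 2) with hS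
  have hSc : Continuous S := by fun_prop
  have hint : ∀ f : C(Fin 3 → ℝ, ℝ), Integrable (fun x => (S x * f x) • u x) (cellMeasure ℓ) :=
    fun f => integrable_smul_cellLp (hSc.mul f.continuous) u
  have hspan : ∀ f ∈ Submodule.span ℝ (range (cosMode ℓ)),
      ∫ x, (S x * f x) • u x ∂(cellMeasure ℓ) = 0 := by
    intro f hf
    induction hf using Submodule.span_induction with
    | mem f hf =>
      obtain ⟨k, rfl⟩ := hf
      obtain ⟨c, d, m, n, hk⟩ := exists_trig_mul_mode_eq (ℓ := ℓ) (σ := fun _ => false) (i := 2)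
        rfl true k
      have hu : Function.update (fun _ : Fin 3 => false) 2 true = modeKind := by
        funext i
        fin_cases i <;> rfl
      rw [hu, trig_true] at hk
      have e : ∀ x, (S x * cosMode ℓ k x) • u x =
          c • (mode ℓ modeKind m x • u x) + d • (mode ℓ modeKind n x • u x) := by
        intro x
        rw [smul_smul, smul_smul, ← add_smul, ← hk x]
        rfl
      simp only [e]
      have hi : ∀ (c : ℝ) m, Integrable (fun x => c • (mode ℓ modeKind m x • u x))
          (cellMeasure ℓ) := fun c m =>
        (integrable_smul_cellLp (contDiff_mode ℓ _ m).continuous u).smul c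
      rw [integral_add (hi c m) (hi d n), integral_smul, integral_smul,
        integral_mode_smul_eq_zero hℓ h, integral_mode_smul_eq_zero hℓ h, smul_zero, smul_zero,
        add_zero]
    | zero => simp
    | add f g _ _ hf hg =>
      simp only [ContinuousMap.add_apply, mul_add, add_smul]
      rw [integral_add (hint f) (hint g), hf, hg, add_zero]
    | smul c f _ hf =>
      simp only [ContinuousMap.smul_apply, smul_eq_mul, mul_left_comm (S _) c, mul_smul c]
      rw [integral_smul, hf, smul_zero]
  have hall : ∀ g : C(Fin 3 → ℝ, ℝ), ∫ x, (S x * g x) • u x ∂(cellMeasure ℓ) = 0 := by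
    intro g
    have hu : Integrable (fun x => ‖u x‖) (cellMeasure ℓ) :=
      ((Lp.memLp u).integrable (by norm_num)).norm
    have hU : 0 ≤ ∫ x, ‖u x‖ ∂(cellMeasure ℓ) := integral_nonneg fun x => norm_nonneg _
    have hle : ∀ ε > 0, ‖∫ x, (S x * g x) • u x ∂(cellMeasure ℓ)‖ ≤
        ε * ∫ x, ‖u x‖ ∂(cellMeasure ℓ) := by
      intro ε hε
      obtain ⟨f, hf, hfg⟩ := exists_cosMode_span_near hℓ g hε
      have e : ∫ x, (S x * g x) • u x ∂(cellMeasure ℓ) =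
          ∫ x, ((S x * g x) • u x - (S x * f x) • u x) ∂(cellMeasure ℓ) := by
        rw [integral_sub (hint g) (hint f), hspan f hf, sub_zero]
      rw [e, ← integral_const_mul]
      refine norm_integral_le_of_norm_le (hu.const_mul ε) ?_
      filter_upwards [ae_mem_box ℓ] with x hx
      rw [← sub_smul, ← mul_sub, norm_smul, norm_mul]
      refine mul_le_mul_of_nonneg_right ?_ (norm_nonneg _)
      refine (mul_le_of_le_one_left (norm_nonneg _) (Real.abs_sin_le_one _)).trans ?_
      rw [Real.norm_eq_abs, abs_sub_comm]
      exact (hfg x (box_subset_Icc ℓ hx)).le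
    rw [← norm_le_zero_iff]
    refine le_of_forall_pos_le_add fun ε hε => ?_
    set U := ∫ x, ‖u x‖ ∂(cellMeasure ℓ)
    -- The `+ 1` avoids dividing by zero when `u` vanishes.
    refine (hle (ε / (U + 1)) (by positivity)).trans ?_
    rw [zero_add, div_mul_eq_mul_div, div_le_iff₀ (by positivity)]
    nlinarith
  have hloc : LocallyIntegrableOn (fun x => S x • u x) (box ℓ) (cellMeasure ℓ) :=
    (integrable_smul_cellLp hSc u).locallyIntegrable.locallyIntegrableOn _
  have hae := (isOpen_box ℓ).ae_eq_zero_of_integral_contDiff_smul_eq_zero hloc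
    (fun φ hφ _ _ => by
      refine (integral_congr_ae (Eventually.of_forall fun x => ?_)).trans
        (hall ⟨φ, hφ.continuous⟩)
      simp only [ContinuousMap.coe_mk, smul_smul, mul_comm (S x)])
  apply Lp.ext
  filter_upwards [hae, ae_mem_box ℓ, Lp.coeFn_zero ℂ 2 (cellMeasure ℓ)] with x hx hm h0
  rw [h0]
  refine (smul_eq_zero.1 (hx hm)).resolve_left (Real.sin_pos_of_pos_of_lt_pi ?_ ?_).ne'
  · exact div_pos (mul_pos Real.pi_pos (hm 2 trivial).1) (hℓ 2)
  · rw [div_lt_iff₀ (hℓ 2)]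
    exact mul_lt_mul_of_pos_left (hm 2 trivial).2 Real.pi_pos

end completeness

/-! ### Operators diagonal in a Hilbert basis -/

section diagonal

variable {H ι : Type*} [NormedAddCommGroup H] [InnerProductSpace ℂ H]

/-- The graph of an operator which is diagonal, with real entries `lam`, in a Hilbert basis. -/
def IsDiagonalGraph (b : HilbertBasis ι ℂ H) (lam : ι → ℝ) (g : Submodule ℂ (H × H)) : Prop :=
  ∀ u f, (u, f) ∈ g ↔ ∀ k, ⟪b k, f⟫_ℂ = lam k * ⟪b k, u⟫_ℂ

theorem _root_.HilbertBasis.eq_of_inner_eq (b : HilbertBasis ι ℂ H) {u v : H}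
    (h : ∀ k, ⟪b k, u⟫_ℂ = ⟪b k, v⟫_ℂ) : u = v := by
  apply b.repr.injective
  ext k
  simpa [b.repr_apply_apply] using h k

variable {b : HilbertBasis ι ℂ H} {lam : ι → ℝ} {g : Submodule ℂ (H × H)}

theorem IsDiagonalGraph.basis_mem (h : IsDiagonalGraph b lam g) (k : ι) :
    (b k, (lam k : ℂ) • b k) ∈ g := by
  classical
  rw [h]
  intro j
  rw [inner_smul_right, orthonormal_iff_ite.1 b.orthonormal]
  split_ifs with hj
  · rw [hj]
  · simp

/-- The coefficients of `f` are determined by those of `u`, so the relation is single-valued and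
loses nothing when turned into an operator. -/
theorem IsDiagonalGraph.graph_eq (h : IsDiagonalGraph b lam g) : g.toLinearPMap.graph = g := by
  refine g.toLinearPMap_graph_eq fun x hx hx' => b.eq_of_inner_eq fun k => ?_
  rw [(h x.1 x.2).1 hx k, hx']
  simp

theorem IsDiagonalGraph.dense_domain [CompleteSpace H] (h : IsDiagonalGraph b lam g) :
    Dense (g.toLinearPMap.domain : Set H) := by
  have : (Submodule.span ℂ (range b) : Submodule ℂ H) ≤ g.toLinearPMap.domain := by
    rw [Submodule.span_le]
    rintro _ ⟨k, rfl⟩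
    exact ⟨_, h.basis_mem k, rfl⟩
  refine Dense.mono this ?_
  exact Submodule.dense_iff_topologicalClosure_eq_top.2 b.dense_span

/-- Testing the adjoint relation on the basis vectors gives the same diagonal condition, `lam` being
real; conversely Parseval gives the symmetry. The diagonal condition is thus already the maximal
domain. -/
theorem IsDiagonalGraph.isSelfAdjoint [CompleteSpace H] (h : IsDiagonalGraph b lam g) :
    IsSelfAdjoint g.toLinearPMap := by
  rw [LinearPMap.isSelfAdjoint_def]
  apply LinearPMap.eq_of_eq_graph
  rw [LinearPMap.adjoint_graph_eq_graph_adjoint h.dense_domain, h.graph_eq]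
  ext ⟨v, w⟩
  rw [Submodule.mem_adjoint_iff, h]
  constructor
  · intro hv k
    have := hv _ _ (h.basis_mem k)
    rw [sub_eq_zero, inner_smul_left, Complex.conj_ofReal] at this
    exact this.symm
  · intro hv x y hxy
    rw [sub_eq_zero, ← b.tsum_inner_mul_inner, ← b.tsum_inner_mul_inner x w]
    refine tsum_congr fun k => ?_
    rw [hv k, ← inner_conj_symm y, ← inner_conj_symm x, (h x y).1 hxy k]
    simp only [map_mul, Complex.conj_ofReal]
    ring

theorem IsDiagonalGraph.mem_eigenspace (h : IsDiagonalGraph b lam g) {μ : ℂ} {u : H} :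
    u ∈ eigenspace g.toLinearPMap μ ↔ ∀ k, (lam k : ℂ) ≠ μ → ⟪b k, u⟫_ℂ = 0 := by
  have : u ∈ eigenspace g.toLinearPMap μ ↔ (u, μ • u) ∈ g := by
    rw [eigenspace, h.graph_eq]
    rfl
  rw [this, h]
  refine forall_congr' fun k => ?_
  rw [inner_smul_right, ← sub_eq_zero, ← sub_mul, mul_eq_zero, sub_eq_zero, eq_comm (a := μ)]
  tauto

theorem IsDiagonalGraph.basis_mem_eigenspace (h : IsDiagonalGraph b lam g) (k : ι) :
    b k ∈ eigenspace g.toLinearPMap (lam k) := by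
  rw [h.mem_eigenspace]
  intro j hj
  exact b.orthonormal.2 (by rintro rfl; exact hj rfl)

theorem IsDiagonalGraph.eigenspace_eq_span (h : IsDiagonalGraph b lam g) {μ : ℂ}
    (hfin : {k | (lam k : ℂ) = μ}.Finite) :
    eigenspace g.toLinearPMap μ = Submodule.span ℂ (b '' {k | (lam k : ℂ) = μ}) := by
  apply le_antisymm
  · intro u hu
    rw [h.mem_eigenspace] at hu
    have hs := b.hasSum_repr u
    have hz : ∀ k ∉ hfin.toFinset, b.repr u k • b k = 0 := by
      intro k hk
      rw [b.repr_apply_apply, hu k (by simpa using hk), zero_smul]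
    rw [hs.unique (hasSum_sum_of_ne_finset_zero hz)]
    refine Submodule.sum_mem _ fun k hk => Submodule.smul_mem _ _ (Submodule.subset_span ?_)
    exact ⟨k, by simpa using hk, rfl⟩
  · rw [Submodule.span_le]
    rintro _ ⟨k, rfl, rfl⟩
    exact h.basis_mem_eigenspace k

theorem IsDiagonalGraph.finiteDimensional_eigenspace (h : IsDiagonalGraph b lam g) {μ : ℂ}
    (hfin : {k | (lam k : ℂ) = μ}.Finite) :
    FiniteDimensional ℂ (eigenspace g.toLinearPMap μ) := by
  rw [h.eigenspace_eq_span hfin]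
  exact FiniteDimensional.span_of_finite ℂ (hfin.image _)

theorem IsDiagonalGraph.finrank_eigenspace (h : IsDiagonalGraph b lam g) {μ : ℂ}
    (hfin : {k | (lam k : ℂ) = μ}.Finite) :
    Module.finrank ℂ (eigenspace g.toLinearPMap μ) = {k | (lam k : ℂ) = μ}.ncard := by
  have := hfin.fintype
  rw [h.eigenspace_eq_span hfin, image_eq_range, finrank_span_eq_card, ← Nat.card_eq_fintype_card]
  · rfl
  · exact b.orthonormal.linearIndependent.comp _ Subtype.val_injective

theorem IsDiagonalGraph.eigenspace_ne_bot_iff (h : IsDiagonalGraph b lam g) {μ : ℂ} :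
    eigenspace g.toLinearPMap μ ≠ ⊥ ↔ ∃ k, (lam k : ℂ) = μ := by
  constructor
  · intro hne
    by_contra! hk
    refine hne ((Submodule.eq_bot_iff _).2 fun u hu => b.eq_of_inner_eq fun k => ?_)
    rw [h.mem_eigenspace.1 hu k (hk k), inner_zero_right]
  · rintro ⟨k, rfl⟩ hbot
    have := h.basis_mem_eigenspace k
    rw [hbot, Submodule.mem_bot] at this
    exact b.orthonormal.ne_zero k this

/-- By Parseval the quadratic form is the sum of `lam k` times the squared moduli of the
coefficients. -/
theorem IsDiagonalGraph.inner_nonneg (h : IsDiagonalGraph b lam g) (hlam : ∀ k, 0 ≤ lam k)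
    {u f : H} (hu : (u, f) ∈ g) : 0 ≤ (⟪f, u⟫_ℂ).re := by
  have hs := b.hasSum_inner_mul_inner f u
  have := Complex.hasSum_re hs
  refine this.nonneg fun k => ?_
  rw [← inner_conj_symm, (h u f).1 hu k, map_mul, Complex.conj_ofReal, mul_assoc,
    Complex.conj_mul', Complex.re_ofReal_mul]
  refine mul_nonneg (hlam k) ?_
  exact_mod_cast sq_nonneg ‖⟪b k, u⟫_ℂ‖

end diagonal

/-! ### Eigenfunction expansions and regularity -/

/-- A family of pairwise orthogonal vectors `v k` of norm `a k` can be summed with coefficients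
`c k` such that `∑ ‖c k‖² (a k)²` converges. -/
theorem summable_smul_of_orthogonal {H ι : Type*} [NormedAddCommGroup H] [InnerProductSpace ℂ H]
    [CompleteSpace H] {v : ι → H} {c : ι → ℂ} (hv : Pairwise fun k l => ⟪v k, v l⟫_ℂ = 0)
    (hs : Summable fun k => ‖c k‖ ^ 2 * ‖v k‖ ^ 2) : Summable fun k => c k • v k := by
  -- The `v k` need not be normalised and may vanish, as does the derivative of a mode constant in
  -- that direction; hence the lines they span are used.
  have hV : OrthogonalFamily ℂ (fun k => Submodule.span ℂ {v k})
      (fun k => (Submodule.span ℂ {v k}).subtypeₗᵢ) := by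
    refine OrthogonalFamily.of_pairwise fun k l hkl => ?_
    change Submodule.span ℂ {v k} ⟂ Submodule.span ℂ {v l}
    rw [Submodule.isOrtho_span]
    rintro _ rfl _ rfl
    exact hv hkl
  refine (hV.summable_iff_norm_sq_summable
    fun k => ⟨c k • v k, Submodule.smul_mem _ _ (Submodule.mem_span_singleton_self _)⟩).2 ?_
  refine hs.congr fun k => ?_
  rw [Submodule.coe_norm, norm_smul, mul_pow]

/-- A normalised eigenfunction as a complex function. -/
def cellModeC (ℓ : Fin 3 → ℝ) (p : ℕ × ℕ × ℕ+) (x : Fin 3 → ℝ) : ℂ := (cellMode ℓ p x : ℂ)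

/-- The eigenvalue of an index. -/
def cellLam (ℓ : Fin 3 → ℝ) (p : ℕ × ℕ × ℕ+) : ℝ := ∑ i, cellFreq ℓ p i ^ 2

section spectral

variable {ℓ : Fin 3 → ℝ} {p q : ℕ × ℕ × ℕ+} {u : CellL2 ℓ}

theorem contDiff_cellModeC (ℓ : Fin 3 → ℝ) (p : ℕ × ℕ × ℕ+) : ContDiff ℝ ∞ (cellModeC ℓ p) :=
  contDiff_ofReal (contDiff_cellMode ℓ p)

theorem pderiv_cellModeC (i : Fin 3) :
    pderiv i (cellModeC ℓ p) = fun x => ((pderiv i (cellMode ℓ p) x : ℝ) : ℂ) :=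
  pderiv_ofReal (contDiff_cellMode ℓ p) i

theorem pderiv_pderiv_cellModeC (i j : Fin 3) : pderiv j (pderiv i (cellModeC ℓ p)) =
    fun x => ((pderiv j (pderiv i (cellMode ℓ p)) x : ℝ) : ℂ) := by
  rw [pderiv_cellModeC, pderiv_ofReal (contDiff_pderiv (contDiff_cellMode ℓ p) i)]

theorem inner_cellModeC (hℓ : ∀ j, 0 < ℓ j) :
    ⟪cellLp ℓ (cellModeC ℓ p), cellLp ℓ (cellModeC ℓ q)⟫_ℂ = if p = q then 1 else 0 := by
  refine (inner_cellLp_cellLp (contDiff_cellMode ℓ p).continuous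
    (contDiff_cellMode ℓ q).continuous).trans ?_
  rw [integral_cellMode_mul hℓ]
  split_ifs <;> simp

theorem inner_pderiv_cellModeC (hℓ : ∀ j, 0 < ℓ j) (i : Fin 3) :
    ⟪cellLp ℓ (pderiv i (cellModeC ℓ p)), cellLp ℓ (pderiv i (cellModeC ℓ q))⟫_ℂ
      = if p = q then ((cellFreq ℓ p i ^ 2 : ℝ) : ℂ) else 0 := by
  rw [pderiv_cellModeC, pderiv_cellModeC,
    inner_cellLp_cellLp (contDiff_pderiv (contDiff_cellMode ℓ p) i).continuous
    (contDiff_pderiv (contDiff_cellMode ℓ q) i).continuous, integral_pderiv_cellMode_mul hℓ]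
  split_ifs <;> simp

theorem inner_pderiv_pderiv_cellModeC (hℓ : ∀ j, 0 < ℓ j) (i j : Fin 3) :
    ⟪cellLp ℓ (pderiv j (pderiv i (cellModeC ℓ p))),
      cellLp ℓ (pderiv j (pderiv i (cellModeC ℓ q)))⟫_ℂ
      = if p = q then ((cellFreq ℓ p j ^ 2 * cellFreq ℓ p i ^ 2 : ℝ) : ℂ) else 0 := by
  rw [pderiv_pderiv_cellModeC, pderiv_pderiv_cellModeC, inner_cellLp_cellLp
    (contDiff_pderiv (contDiff_pderiv (contDiff_cellMode ℓ p) i) j).continuous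
    (contDiff_pderiv (contDiff_pderiv (contDiff_cellMode ℓ q) i) j).continuous,
    integral_pderiv_pderiv_cellMode_mul hℓ]
  split_ifs <;> simp

theorem orthonormal_cellModeC (hℓ : ∀ j, 0 < ℓ j) :
    Orthonormal ℂ fun p => cellLp ℓ (cellModeC ℓ p) :=
  orthonormal_iff_ite.2 fun _ _ => inner_cellModeC hℓ

/-- The Hilbert basis of eigenfunctions. -/
def cellBasis (hℓ : ∀ j, 0 < ℓ j) : HilbertBasis (ℕ × ℕ × ℕ+) ℂ (CellL2 ℓ) :=
  HilbertBasis.mkOfOrthogonalEqBot (orthonormal_cellModeC hℓ) (by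
    refine (Submodule.eq_bot_iff _).2 fun u hu => eq_zero_of_inner_cellMode hℓ fun p => ?_
    exact (Submodule.mem_orthogonal _ _).1 hu _ (Submodule.subset_span ⟨p, rfl⟩))

theorem cellBasis_apply (hℓ : ∀ j, 0 < ℓ j) (p : ℕ × ℕ × ℕ+) :
    cellBasis hℓ p = cellLp ℓ (cellModeC ℓ p) := by
  rw [cellBasis, HilbertBasis.coe_mkOfOrthogonalEqBot]

theorem hasTrace_zero_cellLp {f : (Fin 3 → ℝ) → ℂ} (hf : ContDiff ℝ ∞ f) {i : Fin 3} {c : ℝ}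
    (h : ∀ x, x i = c → f x = 0) : HasTrace i c (cellLp ℓ f) 0 := by
  refine hasTrace_zero_of_hasSum (ι := Unit) (f := fun _ => f) (c := fun _ => 1)
    (w := fun j => cellLp ℓ (pderiv j f)) (fun _ => hf) ?_ (fun j => ?_) (fun _ => h)
  · simp
  · simp

theorem memFormDomain_cellModeC (hℓ : ∀ j, 0 < ℓ j) (p : ℕ × ℕ × ℕ+) :
    MemFormDomain (cellLp ℓ (cellModeC ℓ p)) := by
  refine ⟨memH1_cellLp (contDiff_cellModeC ℓ p), hasTrace_zero_cellLp (contDiff_cellModeC ℓ p) ?_,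
    hasTrace_zero_cellLp (contDiff_cellModeC ℓ p) ?_⟩
  · intro x hx
    rw [cellModeC, cellMode_eq_zero hℓ (Or.inl hx), Complex.ofReal_zero]
  · intro x hx
    rw [cellModeC, cellMode_eq_zero hℓ (Or.inr hx), Complex.ofReal_zero]

/-- The Fourier coefficients of the weak derivatives of a function of the form domain. -/
theorem MemFormDomain.inner_weakDeriv (hℓ : ∀ j, 0 < ℓ j) (hu : MemFormDomain u) (i : Fin 3)
    (p : ℕ × ℕ × ℕ+) : ⟪cellLp ℓ (pderiv i (cellModeC ℓ p)), weakDeriv i u⟫_ℂ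
      = ((cellFreq ℓ p i ^ 2 : ℝ) : ℂ) * ⟪cellLp ℓ (cellModeC ℓ p), u⟫_ℂ := by
  have hs := contDiff_pderiv (contDiff_cellMode ℓ p) i
  have key : ∫ x, pderiv i (pderiv i (cellMode ℓ p)) x • u x ∂(cellMeasure ℓ)
      = - ∫ x, pderiv i (cellMode ℓ p) x • weakDeriv i u x ∂(cellMeasure ℓ) := by
    -- Orthogonally to the plates the boundary term dies by the zero trace of `u`; laterally,
    -- because the derivative of the mode vanishes on the faces.
    by_cases hi : i = 2
    · subst hi
      exact integral_pderiv_smul_of_hasTrace hℓ hu.2.1 hu.2.2 hs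
    · exact (hu.1.isWeakDeriv i).integral_pderiv_smul hs
        (fun x hx => pderiv_cellMode_eq_zero hℓ hi (Or.inl hx))
        (fun x hx => pderiv_cellMode_eq_zero hℓ hi (Or.inr hx))
  rw [pderiv_cellModeC, inner_cellLp hs.continuous, ← neg_eq_iff_eq_neg.2 key]
  refine Eq.trans ?_ (congrArg _ (inner_cellLp (contDiff_cellMode ℓ p).continuous u).symm)
  rw [pderiv_pderiv_cellMode]
  simp only [mul_smul]
  rw [integral_smul, neg_smul, neg_neg, Complex.real_smul]

/-- A further integration by parts, with the roles reversed: laterally the normal derivative of `u`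
has zero trace, and on the plates the mode itself vanishes. -/
theorem inner_weakDeriv_weakDeriv (hℓ : ∀ j, 0 < ℓ j) (hu : MemH2 u)
    (hb : MixedBoundaryConditions u) (i : Fin 3) (p : ℕ × ℕ × ℕ+) :
    ⟪cellLp ℓ (cellModeC ℓ p), weakDeriv i (weakDeriv i u)⟫_ℂ
      = - (((cellFreq ℓ p i ^ 2 : ℝ) : ℂ) * ⟪cellLp ℓ (cellModeC ℓ p), u⟫_ℂ) := by
  have hs := contDiff_cellMode ℓ p
  have hQ : MemFormDomain u := ⟨hu.1, hb.2.2.1, hb.2.2.2⟩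
  have key : ∫ x, pderiv i (cellMode ℓ p) x • weakDeriv i u x ∂(cellMeasure ℓ)
      = - ∫ x, cellMode ℓ p x • weakDeriv i (weakDeriv i u) x ∂(cellMeasure ℓ) := by
    fin_cases i
    · exact integral_pderiv_smul_of_hasTrace hℓ hb.1.1 hb.1.2 hs
    · exact integral_pderiv_smul_of_hasTrace hℓ hb.2.1.1 hb.2.1.2 hs
    · exact ((hu.2 2).isWeakDeriv 2).integral_pderiv_smul hs
        (fun x hx => cellMode_eq_zero hℓ (Or.inl hx)) (fun x hx => cellMode_eq_zero hℓ (Or.inr hx))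
  rw [← hQ.inner_weakDeriv hℓ, pderiv_cellModeC,
    inner_cellLp (contDiff_pderiv hs i).continuous, key, neg_neg]
  exact inner_cellLp hs.continuous _

section expansion

variable {f : CellL2 ℓ}

theorem hasSum_cellModeC (hℓ : ∀ j, 0 < ℓ j) (u : CellL2 ℓ) :
    HasSum (fun p => ⟪cellLp ℓ (cellModeC ℓ p), u⟫_ℂ • cellLp ℓ (cellModeC ℓ p)) u := by
  have := (cellBasis hℓ).hasSum_repr u
  simpa only [(cellBasis hℓ).repr_apply_apply, cellBasis_apply] using this

theorem summable_norm_inner_sq (hℓ : ∀ j, 0 < ℓ j) (u : CellL2 ℓ) :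
    Summable fun p => ‖⟪cellLp ℓ (cellModeC ℓ p), u⟫_ℂ‖ ^ 2 :=
  (orthonormal_cellModeC hℓ).inner_products_summable u

theorem cellFreq_sq_le (i : Fin 3) : cellFreq ℓ p i ^ 2 ≤ cellLam ℓ p :=
  Finset.single_le_sum (f := fun i => cellFreq ℓ p i ^ 2) (fun _ _ => sq_nonneg _)
    (Finset.mem_univ i)

theorem cellLam_nonneg : 0 ≤ cellLam ℓ p := Finset.sum_nonneg fun _ _ => sq_nonneg _

/-- Bessel's inequality for `u` and for `f` together bounds the coefficients of `u` with weight `1 +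
λ²`, hence with any smaller weight. -/
theorem summable_mul_norm_sq (hℓ : ∀ j, 0 < ℓ j)
    (h : ∀ p, ⟪cellLp ℓ (cellModeC ℓ p), f⟫_ℂ = cellLam ℓ p * ⟪cellLp ℓ (cellModeC ℓ p), u⟫_ℂ)
    {a : ℕ × ℕ × ℕ+ → ℝ} (ha : ∀ p, 0 ≤ a p) (ha' : ∀ p, a p ≤ 1 + cellLam ℓ p ^ 2) :
    Summable fun p => ‖⟪cellLp ℓ (cellModeC ℓ p), u⟫_ℂ‖ ^ 2 * a p := by
  refine Summable.of_nonneg_of_le (fun p => mul_nonneg (sq_nonneg _) (ha p)) (fun p => ?_)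
    ((summable_norm_inner_sq hℓ u).add (summable_norm_inner_sq hℓ f))
  rw [h p, norm_mul, Complex.norm_real, mul_pow, Real.norm_eq_abs, sq_abs]
  nlinarith [mul_le_mul_of_nonneg_left (ha' p) (sq_nonneg ‖⟪cellLp ℓ (cellModeC ℓ p), u⟫_ℂ‖)]

theorem norm_sq_eq_of_inner {E : Type*} [NormedAddCommGroup E] [InnerProductSpace ℂ E] {v : E}
    {a : ℝ} (h : ⟪v, v⟫_ℂ = (a : ℂ)) : ‖v‖ ^ 2 = a := by
  rw [inner_self_eq_norm_sq_to_K] at h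
  exact Complex.ofReal_injective (by simpa using h)

theorem summable_pderiv_cellModeC (hℓ : ∀ j, 0 < ℓ j)
    (h : ∀ p, ⟪cellLp ℓ (cellModeC ℓ p), f⟫_ℂ = cellLam ℓ p * ⟪cellLp ℓ (cellModeC ℓ p), u⟫_ℂ)
    (i : Fin 3) : Summable fun p =>
      ⟪cellLp ℓ (cellModeC ℓ p), u⟫_ℂ • cellLp ℓ (pderiv i (cellModeC ℓ p)) := by
  refine summable_smul_of_orthogonal (fun p q hpq => by
    simp only [inner_pderiv_cellModeC hℓ, if_neg hpq]) ?_
  refine summable_mul_norm_sq hℓ h (fun p => sq_nonneg _) fun p => ?_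
  rw [norm_sq_eq_of_inner ((inner_pderiv_cellModeC hℓ i).trans (if_pos rfl))]
  nlinarith [cellFreq_sq_le (ℓ := ℓ) (p := p) i, sq_nonneg (cellLam ℓ p - 1)]

/-- Elliptic regularity in Fourier form: every second derivative, mixed ones included, has squared
weight `freq_j² freq_i² ≤ λ²`, so control of the Laplacian controls the full Hessian. -/
theorem summable_pderiv_pderiv_cellModeC (hℓ : ∀ j, 0 < ℓ j)
    (h : ∀ p, ⟪cellLp ℓ (cellModeC ℓ p), f⟫_ℂ = cellLam ℓ p * ⟪cellLp ℓ (cellModeC ℓ p), u⟫_ℂ)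
    (i j : Fin 3) : Summable fun p =>
      ⟪cellLp ℓ (cellModeC ℓ p), u⟫_ℂ • cellLp ℓ (pderiv j (pderiv i (cellModeC ℓ p))) := by
  refine summable_smul_of_orthogonal (fun p q hpq => by
    simp only [inner_pderiv_pderiv_cellModeC hℓ, if_neg hpq]) ?_
  refine summable_mul_norm_sq hℓ h (fun p => sq_nonneg _) fun p => ?_
  rw [norm_sq_eq_of_inner ((inner_pderiv_pderiv_cellModeC hℓ i j).trans (if_pos rfl))]
  have := mul_le_mul (cellFreq_sq_le (ℓ := ℓ) (p := p) j) (cellFreq_sq_le (ℓ := ℓ) (p := p) i)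
    (sq_nonneg _) cellLam_nonneg
  linarith

/-- The first derivatives of the eigenfunction expansion of a function `u` for which
`∑ λ² |û|² < ∞`. -/
theorem hasSum_weakDeriv (hℓ : ∀ j, 0 < ℓ j)
    (h : ∀ p, ⟪cellLp ℓ (cellModeC ℓ p), f⟫_ℂ = cellLam ℓ p * ⟪cellLp ℓ (cellModeC ℓ p), u⟫_ℂ)
    (i : Fin 3) : HasSum (fun p =>
      ⟪cellLp ℓ (cellModeC ℓ p), u⟫_ℂ • cellLp ℓ (pderiv i (cellModeC ℓ p))) (weakDeriv i u) := by
  have hs := (summable_pderiv_cellModeC hℓ h i).hasSum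
  rwa [← (isWeakDeriv_of_hasSum (contDiff_cellModeC ℓ) (hasSum_cellModeC hℓ u) hs).weakDeriv_eq]
    at hs

theorem memFormDomain_of_inner (hℓ : ∀ j, 0 < ℓ j)
    (h : ∀ p, ⟪cellLp ℓ (cellModeC ℓ p), f⟫_ℂ = cellLam ℓ p * ⟪cellLp ℓ (cellModeC ℓ p), u⟫_ℂ) :
    MemFormDomain u := by
  have ht : ∀ c, (c = 0 ∨ c = ℓ 2) → HasTrace 2 c u 0 := by
    intro c hc
    refine hasTrace_zero_of_hasSum (contDiff_cellModeC ℓ) (hasSum_cellModeC hℓ u)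
      (hasSum_weakDeriv hℓ h) fun p x hx => ?_
    rw [cellModeC, cellMode_eq_zero hℓ (by rwa [hx]), Complex.ofReal_zero]
  exact ⟨(ht 0 (Or.inl rfl)).1, ht 0 (Or.inl rfl), ht _ (Or.inr rfl)⟩

theorem memH2_of_inner (hℓ : ∀ j, 0 < ℓ j)
    (h : ∀ p, ⟪cellLp ℓ (cellModeC ℓ p), f⟫_ℂ = cellLam ℓ p * ⟪cellLp ℓ (cellModeC ℓ p), u⟫_ℂ) :
    MemH2 u :=
  ⟨(memFormDomain_of_inner hℓ h).1, fun i j => ⟨_, isWeakDeriv_of_hasSum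
    (fun p => contDiff_pderiv (contDiff_cellModeC ℓ p) i) (hasSum_weakDeriv hℓ h i)
    (summable_pderiv_pderiv_cellModeC hℓ h i j).hasSum⟩⟩

theorem mixedBoundaryConditions_of_inner (hℓ : ∀ j, 0 < ℓ j)
    (h : ∀ p, ⟪cellLp ℓ (cellModeC ℓ p), f⟫_ℂ = cellLam ℓ p * ⟪cellLp ℓ (cellModeC ℓ p), u⟫_ℂ) :
    MixedBoundaryConditions u := by
  have ht : ∀ i, i ≠ 2 → ∀ c, (c = 0 ∨ c = ℓ i) → HasTrace i c (weakDeriv i u) 0 := by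
    intro i hi c hc
    refine hasTrace_zero_of_hasSum (fun p => contDiff_pderiv (contDiff_cellModeC ℓ p) i)
      (hasSum_weakDeriv hℓ h i) (fun j => (summable_pderiv_pderiv_cellModeC hℓ h i j).hasSum)
      fun p x hx => ?_
    rw [pderiv_cellModeC]
    exact Complex.ofReal_eq_zero.2 (pderiv_cellMode_eq_zero hℓ hi (by rwa [hx]))
  exact ⟨⟨ht 0 (by decide) _ (Or.inl rfl), ht 0 (by decide) _ (Or.inr rfl)⟩,
    ⟨ht 1 (by decide) _ (Or.inl rfl), ht 1 (by decide) _ (Or.inr rfl)⟩,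
    (memFormDomain_of_inner hℓ h).2⟩

end expansion

/-! ### The form operator is diagonal; its domain and eigenvalue multiplicities -/

/-- The graph of the operator associated with the form is diagonal in the basis of
eigenfunctions. -/
theorem isDiagonalGraph_formGraph (hℓ : ∀ j, 0 < ℓ j) :
    IsDiagonalGraph (cellBasis hℓ) (cellLam ℓ) (formGraph ℓ) := by
  intro u f
  simp only [cellBasis_apply]
  constructor
  · rintro ⟨hu, hf⟩ p
    have h := hf _ (memFormDomain_cellModeC hℓ p)
    rw [← inner_conj_symm, ← h, cellForm, map_sum, cellLam, Complex.ofReal_sum, Finset.sum_mul]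
    refine Finset.sum_congr rfl fun i _ => ?_
    rw [inner_conj_symm, weakDeriv_cellLp (contDiff_cellModeC ℓ p), hu.inner_weakDeriv hℓ]
  · intro h
    refine ⟨memFormDomain_of_inner hℓ h, fun v hv => ?_⟩
    -- Pair the expansion of each derivative of `u` with that of `v`. Since `v` is in the form
    -- domain, its own coefficients are known, and summing over `i` rebuilds `λ_p` and so the
    -- Parseval series of `⟪v, f⟫`.
    have h1 : ∀ i, HasSum (fun p => ⟪cellLp ℓ (cellModeC ℓ p), u⟫_ℂ *
        ⟪weakDeriv i v, cellLp ℓ (pderiv i (cellModeC ℓ p))⟫_ℂ) ⟪weakDeriv i v, weakDeriv i u⟫_ℂ := by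
      intro i
      have := (hasSum_weakDeriv hℓ h i).mapL (innerSL ℂ (weakDeriv i v))
      simpa only [innerSL_apply_apply, inner_smul_right] using this
    have h2 := hasSum_sum fun i (_ : i ∈ Finset.univ) => h1 i
    have h3 := (cellBasis hℓ).hasSum_inner_mul_inner v f
    simp only [cellBasis_apply] at h3
    have e : ⟪v, f⟫_ℂ = ∑ i, ⟪weakDeriv i v, weakDeriv i u⟫_ℂ := by
      refine h3.unique (h2.congr_fun fun p => ?_)
      rw [h p, cellLam, Complex.ofReal_sum, Finset.sum_mul, Finset.mul_sum]
      refine Finset.sum_congr rfl fun i _ => ?_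
      rw [← inner_conj_symm (weakDeriv i v), hv.inner_weakDeriv hℓ, map_mul, inner_conj_symm,
        Complex.conj_ofReal]
      ring
    rw [← inner_conj_symm, e, map_sum, cellForm]
    exact Finset.sum_congr rfl fun i _ => (inner_conj_symm _ _).symm

theorem mem_formGraph_weakLaplacian (hℓ : ∀ j, 0 < ℓ j) (hu : MemH2 u)
    (hb : MixedBoundaryConditions u) : (u, - weakLaplacian u) ∈ formGraph ℓ := by
  refine ((isDiagonalGraph_formGraph hℓ) _ _).2 fun p => ?_
  rw [cellBasis_apply, weakLaplacian, inner_neg_right, inner_sum, ← Finset.sum_neg_distrib,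
    cellLam, Complex.ofReal_sum, Finset.sum_mul]
  refine Finset.sum_congr rfl fun i _ => ?_
  rw [inner_weakDeriv_weakDeriv hℓ hu hb, neg_neg]

theorem mem_cellOperator_domain_iff (hℓ : ∀ j, 0 < ℓ j) :
    u ∈ (cellOperator ℓ).domain ↔ MemH2 u ∧ MixedBoundaryConditions u := by
  constructor
  · rintro ⟨⟨u, f⟩, huf, rfl⟩
    have h := (isDiagonalGraph_formGraph hℓ u f).1 huf
    simp only [cellBasis_apply] at h
    exact ⟨memH2_of_inner hℓ h, mixedBoundaryConditions_of_inner hℓ h⟩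
  · rintro ⟨h1, h2⟩
    exact ⟨_, mem_formGraph_weakLaplacian hℓ h1 h2, rfl⟩

theorem finite_setOf_cellLam_eq (hℓ : ∀ j, 0 < ℓ j) (μ : ℂ) :
    {p | (cellLam ℓ p : ℂ) = μ}.Finite := by
  -- With `t` the `i`-th frequency, `t² ≤ λ` and `2 t ≤ t² + 1` give `t ≤ λ + 1`, hence this bound
  -- on the `i`-th index.
  refine ((finite_Iic fun i => ⌊(μ.re + 1) * ℓ i / Real.pi⌋₊).preimage
    modeIndex_injective.injOn).subset ?_
  rintro p rfl i
  refine Nat.le_floor ?_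
  rw [le_div_iff₀ Real.pi_pos, ← div_le_iff₀ (hℓ i), Complex.ofReal_re]
  have := cellFreq_sq_le (ℓ := ℓ) (p := p) i
  rw [cellFreq, freq, mul_comm Real.pi] at this
  nlinarith [sq_nonneg ((modeIndex p i : ℝ) * Real.pi / ℓ i - 1),
    cellLam_nonneg (ℓ := ℓ) (p := p)]

theorem cellLam_eq (ℓ₁ ℓ₂ a : ℝ) (p : ℕ × ℕ × ℕ+) :
    cellLam ![ℓ₁, ℓ₂, a] p = cellEigenvalue ℓ₁ ℓ₂ a p.1 p.2.1 p.2.2 := by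
  simp [cellLam, cellEigenvalue, Fin.sum_univ_three, cellFreq, freq, modeIndex, div_pow, mul_pow]

end spectral

end

end MixedCell

/-! ### The main theorem -/

theorem mainTheorem10 (ℓ₁ ℓ₂ a : ℝ) (hℓ₁ : 0 < ℓ₁) (hℓ₂ : 0 < ℓ₂) (ha : 0 < a) :
    -- the form determines the operator `L`, which is self-adjoint and positive
    ((∀ u f : MixedCell.CellL2 ![ℓ₁, ℓ₂, a],
        (u, f) ∈ (MixedCell.cellOperator ![ℓ₁, ℓ₂, a]).graph ↔
          MixedCell.MemFormDomain u ∧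
            ∀ v, MixedCell.MemFormDomain v → MixedCell.cellForm u v = inner ℂ f v) ∧
      IsSelfAdjoint (MixedCell.cellOperator ![ℓ₁, ℓ₂, a]) ∧
      (∀ u : (MixedCell.cellOperator ![ℓ₁, ℓ₂, a]).domain,
        0 ≤ (inner ℂ (MixedCell.cellOperator ![ℓ₁, ℓ₂, a] u)
          (u : MixedCell.CellL2 ![ℓ₁, ℓ₂, a])).re)) ∧
    -- `L` is the Laplacian with lateral Neumann and plate Dirichlet conditions
    ((∀ u : MixedCell.CellL2 ![ℓ₁, ℓ₂, a],
        u ∈ (MixedCell.cellOperator ![ℓ₁, ℓ₂, a]).domain ↔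
          MixedCell.MemH2 u ∧ MixedCell.MixedBoundaryConditions u) ∧
      (∀ u : (MixedCell.cellOperator ![ℓ₁, ℓ₂, a]).domain,
        MixedCell.cellOperator ![ℓ₁, ℓ₂, a] u
          = - MixedCell.weakLaplacian (u : MixedCell.CellL2 ![ℓ₁, ℓ₂, a]))) ∧
    -- the eigenvalues of `L`
    (∀ μ : ℂ, MixedCell.eigenspace (MixedCell.cellOperator ![ℓ₁, ℓ₂, a]) μ ≠ ⊥ ↔
      ∃ (m n : ℕ) (r : ℕ+), μ = (MixedCell.cellEigenvalue ℓ₁ ℓ₂ a m n r : ℂ)) ∧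
    -- each eigenvalue has as multiplicity the number of triples `(m, n, r)` giving it
    (∀ μ : ℂ,
      FiniteDimensional ℂ (MixedCell.eigenspace (MixedCell.cellOperator ![ℓ₁, ℓ₂, a]) μ) ∧
      Module.finrank ℂ (MixedCell.eigenspace (MixedCell.cellOperator ![ℓ₁, ℓ₂, a]) μ) =
        {p : ℕ × ℕ × ℕ+ |
          (MixedCell.cellEigenvalue ℓ₁ ℓ₂ a p.1 p.2.1 p.2.2 : ℂ) = μ}.ncard) ∧
    -- the eigenvectors can be chosen to form an orthonormal (Hilbert) basis
    (∃ b : HilbertBasis (ℕ × ℕ × ℕ+) ℂ (MixedCell.CellL2 ![ℓ₁, ℓ₂, a]),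
      ∀ (m n : ℕ) (r : ℕ+),
        b (m, n, r) ∈ MixedCell.eigenspace (MixedCell.cellOperator ![ℓ₁, ℓ₂, a])
          (MixedCell.cellEigenvalue ℓ₁ ℓ₂ a m n r : ℂ)) := by
  have hℓ : ∀ j, 0 < (![ℓ₁, ℓ₂, a] : Fin 3 → ℝ) j := by
    intro j
    fin_cases j
    · exact hℓ₁
    · exact hℓ₂
    · exact ha
  have hD := MixedCell.isDiagonalGraph_formGraph hℓ
  have hgraph : (MixedCell.cellOperator ![ℓ₁, ℓ₂, a]).graph = MixedCell.formGraph ![ℓ₁, ℓ₂, a] :=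
    hD.graph_eq
  have hmem : ∀ u : (MixedCell.cellOperator ![ℓ₁, ℓ₂, a]).domain,
      ((u : MixedCell.CellL2 ![ℓ₁, ℓ₂, a]), MixedCell.cellOperator ![ℓ₁, ℓ₂, a] u)
        ∈ MixedCell.formGraph ![ℓ₁, ℓ₂, a] := fun u => by
    rw [← hgraph]
    exact LinearPMap.mem_graph _ u
  have hfin := MixedCell.finite_setOf_cellLam_eq hℓ
  have hset : ∀ μ : ℂ, {p : ℕ × ℕ × ℕ+ |
      (MixedCell.cellEigenvalue ℓ₁ ℓ₂ a p.1 p.2.1 p.2.2 : ℂ) = μ}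
        = {p | (MixedCell.cellLam ![ℓ₁, ℓ₂, a] p : ℂ) = μ} := fun μ => by
    simp only [MixedCell.cellLam_eq]
  refine ⟨⟨fun u f => ?_, hD.isSelfAdjoint, fun u => ?_⟩,
    ⟨fun u => MixedCell.mem_cellOperator_domain_iff hℓ, fun u => ?_⟩, fun μ => ?_,
    fun μ => ⟨hD.finiteDimensional_eigenspace (hfin μ), ?_⟩, MixedCell.cellBasis hℓ,
    fun m n r => ?_⟩
  · rw [hgraph]
    exact Iff.rfl
  · exact hD.inner_nonneg (fun p => MixedCell.cellLam_nonneg) (hmem u)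
  -- Both `(u, L u)` and `(u, -Δu)` lie in the graph, which is single-valued.
  · have h := (MixedCell.mem_cellOperator_domain_iff hℓ).1 u.2
    have h1 := MixedCell.mem_formGraph_weakLaplacian hℓ h.1 h.2
    have h2 := hmem u
    rw [← hgraph] at h1 h2
    exact LinearPMap.mem_graph_snd_inj _ h2 h1 rfl
  · refine hD.eigenspace_ne_bot_iff.trans ?_
    simp only [Prod.exists, MixedCell.cellLam_eq, eq_comm]
  · rw [hset]
    exact hD.finrank_eigenspace (hfin μ)
  · rw [← MixedCell.cellLam_eq ℓ₁ ℓ₂ a (m, n, r)]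
    exact hD.basis_mem_eigenspace (m, n, r)
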